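/- For a finite non-empty graph $G$, order the vertices of $G$ uniformly at random and build an independent set $\mathbf I(G)$ by considering the vertices one by one in this order, adding a vertex whenever the resulting set spans no edge. Let $\iota(G)=|\mathbf I(G)|/|V(G)|$ be the (random) greedy independence ratio. For a rooted graph $(U,\rho)$, let $\sigma=(\sigma_v)_{v\in V(U)}$ be independent labels, uniform in $[0,1]$, and let the past of $\rho$ be the set of vertices (including $\rho$) that can be reached from $\rho$ by a path along which the labels strictly decrease. If the past of $\rho$ is almost surely finite, we say that $(U,\rho)$ has nonexplosive growth, and we let $\iota(U,\rho)$ be the probability that $\rho$ belongs to the greedy independent set of the subgraph of $U$ induced by the past of $\rho$, its vertices being considered in increasing order of their labels. Let $d\ge 3$ be an integer and let $$c_d=\tfrac12\left(1-(d-1)^{-2/(d-2)}\right).$$ 1. The $d$-regular tree $\mathbb T_d$, with any vertex $\rho$ as its root, has nonexplosive growth, and $\iota(\mathbb T_d,\rho)=c_d$. 2. If $(G_n)$ is a sequence of finite $d$-regular graphs whose girth tends to infinity, then $\iota(G_n)\to c_d$ with high probability; that is, for every $\varepsilon>0$, $\mathbb P\left[|\iota(G_n)-c_d|<\varepsilon\right]\to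 1$ as $n\to\infty$. 3. Let $G(n,d)$ be a uniformly random $d$-regular simple graph on $n$ labelled vertices ($dn$ even). Then $\iota(G(n,d))\to c_d$ with high probability; that is, for every $\varepsilon>0$, $\mathbb P\left[|\iota(G(n,d))-c_d|<\varepsilon\right]\to 1$ as $n\to\infty$ along the integers $n$ with $dn$ even, where the probability is over both the random graph and the random ordering of its vertices. -/

import Mathlib

open Filter Topology MeasureTheory

noncomputable section

/-- One step of the greedy algorithm: the vertex `v` is added to the set `I` built so far exactly
when the resulting set spans no edge of `G`. -/
def greedyStep {V : Type*} (G : SimpleGraph V) (I : Set V) (v : V) : Set V :=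
  open Classical in if G.IsIndepSet (insert v I) then insert v I else I

/-- The set built by the greedy algorithm on `G` when the vertices are considered one by one in
the order of the list `l`. -/
def greedyMIS {V : Type*} (G : SimpleGraph V) (l : List V) : Set V :=
  l.foldl (greedyStep G) ∅

/-- The orderings of the vertices of a finite graph: `π i` is the `i`-th vertex. -/
abbrev VertexOrder (V : Type*) [Fintype V] : Type _ := Fin (Fintype.card V) ≃ V

/-- The greedy independence ratio `|I(G)| / |V(G)|` for the ordering `π` of the vertices. -/
def greedyRatio {V : Type*} [Fintype V] (G : SimpleGraph V) (π : VertexOrder V) : ℝ :=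
  ((greedyMIS G (List.ofFn π)).ncard : ℝ) / (Fintype.card V : ℝ)

/-- The probability of the event `p` for a uniformly random element of the finite type `Ω`. -/
def uniformProb (Ω : Type*) [Finite Ω] (p : Ω → Prop) : ℝ :=
  (Nat.card {ω : Ω // p ω} : ℝ) / (Nat.card Ω : ℝ)

/-- The `d`-regular (simple) graphs on the vertex set `Fin n`. -/
abbrev RegularGraphOn (n d : ℕ) : Type :=
  open Classical in {G : SimpleGraph (Fin n) // G.IsRegularOfDegree d}

/-- The past of `v` with respect to the labelling `σ`: all vertices that are reachable from `v` by
a path along which the labels strictly decrease (`v` itself included). -/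
def past {V : Type*} (G : SimpleGraph V) (σ : V → unitInterval) (v : V) : Set V :=
  {u | Relation.ReflTransGen (fun a b => G.Adj a b ∧ σ b < σ a) v u}

/-- The law of a random labelling: independent labels, uniform in `[0,1]`. -/
def labelMeasure (V : Type*) : Measure (V → unitInterval) :=
  Measure.infinitePi (fun _ : V => (volume : Measure unitInterval))

/-- The rooted graph `(U, ρ)` has nonexplosive growth: the past of the root is almost surely
finite. -/
def NonexplosiveGrowth {V : Type*} (U : SimpleGraph V) (ρ : V) : Prop :=
  ∀ᵐ σ ∂(labelMeasure V), (past U σ ρ).Finite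

/-- The vertices of a finite graph listed in increasing order of their labels. (Ties, which have
probability zero for a random labelling, are broken in an arbitrary way.) -/
def labelOrder {W : Type*} [Fintype W] (σ : W → unitInterval) : List W :=
  (Finset.univ : Finset W).toList.mergeSort (fun u v => decide (σ u ≤ σ v))

/-- The event that the past of `ρ` is finite and `ρ` belongs to the greedy independent set of the
subgraph of `U` induced by the past of `ρ`, where vertices are considered in increasing order of
their labels. -/
def rootOccupied {V : Type*} (U : SimpleGraph V) (ρ : V) : Set (V → unitInterval) :=
  {σ | ∃ h : (past U σ ρ).Finite,
    (⟨ρ, Relation.ReflTransGen.refl⟩ : past U σ ρ) ∈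
      greedyMIS (U.induce (past U σ ρ))
        (@labelOrder (past U σ ρ) h.fintype (fun v => σ v))}

/-- The probability `ι(U, ρ)` that the root belongs to the greedy independent set of its past;
meaningful when `(U, ρ)` has nonexplosive growth. -/
def greedyDensity {V : Type*} (U : SimpleGraph V) (ρ : V) : ℝ :=
  (labelMeasure V).real (rootOccupied U ρ)

end

/-! Replace the random order by independent uniform labels. A vertex is then selected exactly when
no neighbour with a smaller label is selected (`mem_greedyMIS_iff`). This recursion reverses
inclusions, so iterating it from the predicate that is true everywhere gives alternating bounds: odd
rounds lie below the greedy set, even rounds above it (`occ_sandwich`). It therefore suffices to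
understand the `k`-round predicate `occ`, which depends only on labels within distance `k`.

Where the neighbourhood is a tree, the branches below a vertex use disjoint sets of labels. The
probability that a non-root vertex has label below `x` and is occupied then runs through the Picard
iterates of `p' = (1 - p)^(d-1)`, `p(0) = 0` (`occLabel_branch`). The root has `d` branches instead
of `d - 1`, so its occupation probability is the integral of `(1 - p)^d` (`measureReal_occ`). The
iterates converge uniformly to `1 - y` with `y(x) = (1 + (d-2)x)^(-1/(d-2))`, and the integral of
`y^d` is `(1 - y(1)^2)/2`, which is `c` (`tendsto_integral_picard`). Lower and upper bounds share
this limit, which settles the tree (`greedyDensity_tree`). The past is almost surely finite because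
a decreasing path with `k` steps exists with probability at most `d^k/(k+1)!`.

In a finite `d`-regular graph on `n` vertices, the number of vertices occupied after `k` rounds has
the tree mean up to the number of vertices close to a cycle, and variance of order `n`, since
distant vertices are independent. Chebyshev's inequality gives one estimate for all such graphs with
few vertices close to a cycle (`exists_uniformProb_ge`). Large girth leaves no such vertices. For
random regular graphs, a switching argument bounds the proportion containing `l` prescribed edges by
`(2d/n)^l` (`card_regularContaining_mul_le`); hence the mean number of vertices close to a cycle
stays bounded (`sum_cyclicCount_le`), and Markov's inequality applies. -/

/-! ### The greedy recursion and its alternating bounds -/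

/-- Occupation of `v` after `k` rounds of the greedy recursion, looking only at the neighbours of
`v` other than `w`. -/
def occ {V : Type*} (G : SimpleGraph V) (σ : V → unitInterval) : ℕ → V → V → Prop
  | 0, _, _ => True
  | k + 1, w, v => ∀ u, G.Adj v u → u ≠ w → σ u < σ v → ¬ occ G σ k v u

/-- Ignoring `w` costs nothing when `w` has the larger label, since only smaller neighbours are
consulted. The exclusion is built into `occ` so that it never looks back towards the parent, even
without a comparison of labels. -/
lemma occ_congr_of_lt {V : Type*} {G : SimpleGraph V} {σ : V → unitInterval} {w v : V}
    (h : σ v < σ w) (k : ℕ) : occ G σ k w v ↔ occ G σ k v v := by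
  cases k with
  | zero => exact Iff.rfl
  | succ k =>
    refine forall_congr' fun u => forall_congr' fun hu => ?_
    have := hu.ne'
    refine ⟨fun H _ hlt => H ?_ hlt, fun H _ hlt => H this hlt⟩
    rintro rfl
    exact absurd (hlt.trans h) (lt_irrefl _)

/-- There are no loops, so excluding `v` among its own neighbours is vacuous: on the diagonal, `occ`
follows the true greedy recursion. -/
lemma occ_succ_self {V : Type*} {G : SimpleGraph V} {σ : V → unitInterval} {v : V} (k : ℕ) :
    occ G σ (k + 1) v v ↔ ∀ u, G.Adj v u → σ u < σ v → ¬ occ G σ k u u := by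
  refine forall_congr' fun u => forall_congr' fun hu => ?_
  refine ⟨fun H hlt => ?_, fun H _ hlt => ?_⟩
  · rw [← occ_congr_of_lt hlt]; exact H hu.ne' hlt
  · rw [occ_congr_of_lt hlt]; exact H hlt

/-- A solution of the greedy recursion on a set closed under passing to smaller neighbours lies
between two consecutive iterates. -/
lemma occ_sandwich {V : Type*} {G : SimpleGraph V} {σ : V → unitInterval} {P J : V → Prop}
    (hP : ∀ v u, P v → G.Adj v u → σ u < σ v → P u)
    (hJ : ∀ v, P v → (J v ↔ ∀ u, G.Adj v u → σ u < σ v → ¬ J u)) (k : ℕ) :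
    ∀ v, P v → (occ G σ (2 * k + 1) v v → J v) ∧ (J v → occ G σ (2 * k) v v) := by
  -- The recursion is antitone, so an upper bound on smaller neighbours becomes a lower bound one
  -- round later, and conversely. Round 0 is trivially an upper bound.
  have even_to_odd : ∀ k, (∀ v, P v → J v → occ G σ k v v) →
      ∀ v, P v → occ G σ (k + 1) v v → J v := by
    intro k hk v hv h
    rw [occ_succ_self] at h
    exact (hJ v hv).2 fun u hu hlt hJu => h u hu hlt (hk u (hP v u hv hu hlt) hJu)
  have odd_to_even : ∀ k, (∀ v, P v → occ G σ k v v → J v) →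
      ∀ v, P v → J v → occ G σ (k + 1) v v := by
    intro k hk v hv h
    rw [occ_succ_self]
    exact fun u hu hlt ho => (hJ v hv).1 h u hu hlt (hk u (hP v u hv hu hlt) ho)
  have even : ∀ k, ∀ v, P v → J v → occ G σ (2 * k) v v := by
    intro k
    induction k with
    | zero => intros; trivial
    | succ k ih => exact odd_to_even (2 * k + 1) (even_to_odd (2 * k) ih)
  exact fun v hv => ⟨even_to_odd (2 * k) (even k) v hv, even k v hv⟩

/-! ### The greedy algorithm -/

lemma mem_greedyStep_of_ne {V : Type*} {G : SimpleGraph V} {I : Set V} {x v : V} (h : x ≠ v) :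
    x ∈ greedyStep G I v ↔ x ∈ I := by
  unfold greedyStep
  split_ifs <;> simp [h]

lemma mem_foldl_greedyStep {V : Type*} {G : SimpleGraph V} {x : V} (l : List V) :
    ∀ I : Set V, x ∉ l → (x ∈ l.foldl (greedyStep G) I ↔ x ∈ I) := by
  induction l with
  | nil => intro I _; rfl
  | cons a l ih =>
    intro I h
    rw [List.mem_cons, not_or] at h
    rw [List.foldl_cons, ih _ h.2, mem_greedyStep_of_ne h.1]

lemma isIndepSet_foldl_greedyStep {V : Type*} {G : SimpleGraph V} (l : List V) :
    ∀ I : Set V, G.IsIndepSet I → G.IsIndepSet (l.foldl (greedyStep G) I) := by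
  induction l with
  | nil => intro I h; exact h
  | cons a l ih =>
    intro I h
    refine ih _ ?_
    unfold greedyStep
    split_ifs with h'
    · exact h'
    · exact h

lemma mem_greedyStep_self {V : Type*} {G : SimpleGraph V} {I : Set V} {v : V}
    (hI : G.IsIndepSet I) (hv : v ∉ I) :
    v ∈ greedyStep G I v ↔ ∀ u ∈ I, ¬ G.Adj v u := by
  unfold greedyStep
  have : G.IsIndepSet (insert v I) ↔ ∀ u ∈ I, ¬ G.Adj v u := by
    rw [SimpleGraph.isIndepSet_iff, Set.pairwise_insert]
    exact ⟨fun h u hu => (h.2 u hu (fun e => hv (e ▸ hu))).1,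
      fun h => ⟨hI, fun u hu _ => ⟨h u hu, fun h' => h u hu h'.symm⟩⟩⟩
  split_ifs with h
  · simpa using this.1 h
  · simp [hv, ← this, h]

/-- The fate of a vertex is sealed when it is processed: later steps neither add nor remove it, so
only its predecessors matter, and their final status is already known then. -/
lemma mem_greedyMIS_append {V : Type*} {G : SimpleGraph V} {v : V} {l₁ l₂ : List V}
    (h : (l₁ ++ v :: l₂).Nodup) :
    v ∈ greedyMIS G (l₁ ++ v :: l₂) ↔
      ∀ u ∈ l₁, G.Adj v u → u ∉ greedyMIS G (l₁ ++ v :: l₂) := by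
  rw [List.nodup_append] at h
  obtain ⟨h1, h2, h3⟩ := h
  have hv2 : v ∉ l₂ := (List.nodup_cons.1 h2).1
  have hv1 : v ∉ l₁ := fun hm => h3 v hm v (by simp) rfl
  have hI : G.IsIndepSet (l₁.foldl (greedyStep G) ∅) :=
    isIndepSet_foldl_greedyStep _ _ (by simp [SimpleGraph.isIndepSet_iff])
  have hvI : v ∉ l₁.foldl (greedyStep G) ∅ := by
    rw [mem_foldl_greedyStep _ _ hv1]; simp
  have hmem : ∀ u ∈ l₁, (u ∈ greedyMIS G (l₁ ++ v :: l₂) ↔ u ∈ l₁.foldl (greedyStep G) ∅) := by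
    intro u hu
    have : u ∉ v :: l₂ := fun hm => h3 u hu u hm rfl
    rw [greedyMIS, List.foldl_append, mem_foldl_greedyStep _ _ this]
  have hself : v ∈ greedyMIS G (l₁ ++ v :: l₂) ↔ ∀ u ∈ l₁.foldl (greedyStep G) ∅, ¬ G.Adj v u := by
    rw [greedyMIS, List.foldl_append, List.foldl_cons, mem_foldl_greedyStep _ _ hv2,
      mem_greedyStep_self hI hvI]
  rw [hself]
  constructor
  · intro H u hu ha hm
    exact H u ((hmem u hu).1 hm) ha
  · intro H u hu ha
    by_cases hul : u ∈ l₁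
    · exact H u hul ha ((hmem u hul).2 hu)
    · rw [mem_foldl_greedyStep _ _ hul] at hu; exact hu

/-- If the vertices are listed in increasing order of their labels and adjacent vertices have
distinct labels, then the greedy independent set solves the greedy recursion. -/
lemma mem_greedyMIS_iff {V : Type*} {G : SimpleGraph V} {σ : V → unitInterval} {l : List V}
    (hnd : l.Nodup) (hfull : ∀ v, v ∈ l) (hs : l.Pairwise (fun u v => σ u ≤ σ v))
    (hties : ∀ u v, G.Adj u v → σ u ≠ σ v) (v : V) :
    v ∈ greedyMIS G l ↔ ∀ u, G.Adj v u → σ u < σ v → u ∉ greedyMIS G l := by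
  obtain ⟨l₁, l₂, rfl⟩ := List.append_of_mem (hfull v)
  rw [mem_greedyMIS_append hnd]
  rw [List.pairwise_append, List.pairwise_cons] at hs
  obtain ⟨-, ⟨h2, -⟩, h3⟩ := hs
  constructor
  · intro H u ha hlt
    refine H u ?_ ha
    have := hfull u
    simp only [List.mem_append, List.mem_cons] at this
    rcases this with h | rfl | h
    · exact h
    · exact absurd hlt (lt_irrefl _)
    · exact absurd hlt (not_lt.2 (h2 u h))
  · intro H u hu ha
    exact H u ha (lt_of_le_of_ne (h3 u hu v (by simp)) (hties u v ha.symm))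

/-! ### Measurability, locality and independence -/

instance {V : Type*} : IsProbabilityMeasure (labelMeasure V) := by
  unfold labelMeasure; infer_instance

/-- The label of `v` if `v` is occupied after `k` rounds, and the top label otherwise. -/
noncomputable def occLabel {V : Type*} (G : SimpleGraph V) (k : ℕ) (w v : V)
    (σ : V → unitInterval) : unitInterval :=
  open Classical in if occ G σ k w v then σ v else 1

/-- An unoccupied neighbour carries the top label 1 and so imposes no constraint. This turns
occupation into a comparison of `σ v` with an infimum. -/
lemma occ_succ_iff {V : Type*} {G : SimpleGraph V} {σ : V → unitInterval} {k : ℕ} {w v : V} :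
    occ G σ (k + 1) w v ↔ ∀ u, G.Adj v u → u ≠ w → σ v ≤ occLabel G k v u σ := by
  refine forall_congr' fun u => forall_congr' fun hu => forall_congr' fun hw => ?_
  unfold occLabel
  split_ifs with h
  · simp [h]
  · simp [h, unitInterval.le_one']

lemma measurableSet_occ {V : Type*} (G : SimpleGraph V) [G.LocallyFinite] (k : ℕ) :
    ∀ w v, MeasurableSet {σ : V → unitInterval | occ G σ k w v} := by
  induction k with
  | zero => intro w v; simp [occ]
  | succ k ih =>
    intro w v
    have : {σ : V → unitInterval | occ G σ (k + 1) w v} =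
        ⋂ u ∈ G.neighborFinset v, {σ | u ≠ w → σ u < σ v → ¬ occ G σ k v u} := by
      ext σ; simp [occ]
    rw [this]
    refine Finset.measurableSet_biInter _ fun u _ => ?_
    by_cases huw : u = w
    · simp [huw]
    · have : {σ : V → unitInterval | u ≠ w → σ u < σ v → ¬ occ G σ k v u} =
          ({σ | σ u < σ v} ∩ {σ | occ G σ k v u})ᶜ := by
        ext σ; simp [huw]
      rw [this]
      exact ((measurableSet_lt (measurable_pi_apply u) (measurable_pi_apply v)).inter
        (ih v u)).compl

lemma measurable_occLabel {V : Type*} (G : SimpleGraph V) [G.LocallyFinite] (k : ℕ) (w v : V) :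
    Measurable (occLabel G k w v) := by
  classical
  unfold occLabel
  exact Measurable.ite (measurableSet_occ G k w v) (measurable_pi_apply v) measurable_const

/-- The function is unchanged if all labels outside `S` are first reset to 0, and this reset map is
measurable with respect to the labels in `S`. -/
lemma comap_le_of_dependsOn {V δ : Type*} [MeasurableSpace δ] {h : (V → unitInterval) → δ}
    {S : Set V} (hh : Measurable h) (hS : DependsOn h S) :
    MeasurableSpace.comap h inferInstance ≤
      ⨆ i ∈ S, MeasurableSpace.comap (fun σ : V → unitInterval => σ i) inferInstance := by
  classical
  have e : h = h ∘ fun σ i => if i ∈ S then σ i else 0 := by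
    ext σ
    refine hS fun i hi => ?_
    simp [hi]
  rw [e, ← MeasurableSpace.comap_comp]
  refine (MeasurableSpace.comap_mono hh.comap_le).trans ?_
  rw [← measurable_iff_comap_le]
  refine @measurable_pi_iff _ _ _ (_) _ _ |>.2 fun i => ?_
  by_cases hi : i ∈ S
  · simp only [hi, if_true]
    refine measurable_iff_comap_le.2 ?_
    exact le_iSup₂ (f := fun i (_ : i ∈ S) =>
      MeasurableSpace.comap (fun σ : V → unitInterval => σ i) inferInstance) i hi
  · simp only [hi, if_false]
    exact @measurable_const _ _ _ (_) _

open ProbabilityTheory in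
/-- Functions of the labels depending on disjoint sets of labels are independent. -/
lemma indepFun_of_dependsOn {V β γ : Type*} [MeasurableSpace β] [MeasurableSpace γ]
    {f : (V → unitInterval) → β} {g : (V → unitInterval) → γ} (hf : Measurable f)
    (hg : Measurable g) {S T : Set V} (hfS : DependsOn f S) (hgT : DependsOn g T)
    (hST : Disjoint S T) : IndepFun f g (labelMeasure V) := by
  have hind : iIndepFun (fun (i : V) (σ : V → unitInterval) => σ i) (labelMeasure V) :=
    iIndepFun_infinitePi (P := fun _ : V => (volume : Measure unitInterval))
      (X := fun _ x => x) (fun _ => measurable_id)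
  have := indep_iSup_of_disjoint (fun i => (measurable_pi_apply i).comap_le) hind hST
  rw [IndepFun_iff_Indep]
  exact indep_of_indep_of_le_left (indep_of_indep_of_le_right this (comap_le_of_dependsOn hg hgT))
    (comap_le_of_dependsOn hf hfS)

lemma map_labelMeasure_comp {V W : Type*} {f : W → V} (hf : Function.Injective f) :
    (labelMeasure V).map (fun σ => σ ∘ f) = labelMeasure W :=
  Measure.map_infinitePi_infinitePi_of_inj
    (P := fun _ : V => (volume : Measure unitInterval)) hf

/-! ### The limiting differential equation -/

/-- The probability that a vertex of the infinite `m`-ary tree has label less than `x` and is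
occupied after `k` rounds of the greedy recursion. -/
noncomputable def picard (m : ℕ) : ℕ → ℝ → ℝ
  | 0, x => x
  | k + 1, x => ∫ t in (0 : ℝ)..x, (1 - picard m k t) ^ m

lemma continuous_picard (m k : ℕ) : Continuous (picard m k) := by
  induction k with
  | zero => exact continuous_id
  | succ k ih =>
    exact intervalIntegral.continuous_primitive
      (fun a b => ((continuous_const.sub ih).pow m).intervalIntegrable a b) 0

lemma picard_mem (m k : ℕ) : ∀ x ∈ Set.Icc (0 : ℝ) 1, picard m k x ∈ Set.Icc (0 : ℝ) x := by
  induction k with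
  | zero => intro x hx; exact ⟨hx.1, le_rfl⟩
  | succ k ih =>
    intro x hx
    have hmem : ∀ t ∈ Set.Icc (0 : ℝ) x, (1 - picard m k t) ^ m ∈ Set.Icc (0 : ℝ) 1 := by
      intro t ht
      have := ih t ⟨ht.1, ht.2.trans hx.2⟩
      have h1 : 0 ≤ 1 - picard m k t := by linarith [this.2, ht.2, hx.2]
      exact ⟨pow_nonneg h1 m, pow_le_one₀ h1 (by linarith [this.1])⟩
    have hc : Continuous fun t => (1 - picard m k t) ^ m :=
      (continuous_const.sub (continuous_picard m k)).pow m
    refine ⟨intervalIntegral.integral_nonneg hx.1 fun t ht => (hmem t ht).1, ?_⟩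
    calc picard m (k + 1) x ≤ ∫ _t in (0 : ℝ)..x, (1 : ℝ) :=
          intervalIntegral.integral_mono_on hx.1 (hc.intervalIntegrable 0 x)
            (continuous_const.intervalIntegrable 0 x) fun t ht => (hmem t ht).2
      _ = x := by simp

lemma abs_pow_sub_pow_le_of_mem {a b : ℝ} (ha : a ∈ Set.Icc (0 : ℝ) 1) (hb : b ∈ Set.Icc (0 : ℝ) 1)
    (m : ℕ) : |a ^ m - b ^ m| ≤ m * |a - b| := by
  have h := abs_pow_sub_pow_le a b m
  refine h.trans ?_
  have : max |a| |b| ^ (m - 1) ≤ 1 := by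
    refine pow_le_one₀ (le_max_of_le_left (abs_nonneg a)) (max_le ?_ ?_)
    · rw [abs_of_nonneg ha.1]; exact ha.2
    · rw [abs_of_nonneg hb.1]; exact hb.2
  calc |a - b| * m * max |a| |b| ^ (m - 1) ≤ |a - b| * m * 1 := by gcongr
    _ = m * |a - b| := by ring

/-- Convergence of the Picard iterates to a solution of the integral equation. -/
lemma abs_picard_sub_le {m : ℕ} {y : ℝ → ℝ} (hy : ContinuousOn y (Set.Icc 0 1))
    (hy1 : ∀ x ∈ Set.Icc (0 : ℝ) 1, y x ∈ Set.Icc (0 : ℝ) 1)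
    (hsol : ∀ x ∈ Set.Icc (0 : ℝ) 1, 1 - y x = ∫ t in (0 : ℝ)..x, y t ^ m) (k : ℕ) :
    ∀ x ∈ Set.Icc (0 : ℝ) 1, |(1 - picard m k x) - y x| ≤ (m * x) ^ k / k.factorial := by
  induction k with
  | zero =>
    intro x hx
    have h1 := picard_mem m 0 x hx
    have h2 := hy1 x hx
    simp only [pow_zero, Nat.factorial_zero, Nat.cast_one, div_one]
    rw [abs_le]
    constructor <;> linarith [h1.1, h1.2, h2.1, h2.2, hx.2]
  | succ k ih =>
    intro x hx
    have hsub : Set.uIcc 0 x ⊆ Set.Icc (0 : ℝ) 1 := by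
      rw [Set.uIcc_of_le hx.1]; exact Set.Icc_subset_Icc le_rfl hx.2
    have hc1 : IntervalIntegrable (fun t => (1 - picard m k t) ^ m) volume 0 x :=
      ((continuous_const.sub (continuous_picard m k)).pow m).intervalIntegrable 0 x
    have hc2 : IntervalIntegrable (fun t => y t ^ m) volume 0 x :=
      ((hy.mono hsub).pow m).intervalIntegrable
    have e : (1 - picard m (k + 1) x) - y x =
        -∫ t in (0 : ℝ)..x, ((1 - picard m k t) ^ m - y t ^ m) := by
      rw [intervalIntegral.integral_sub hc1 hc2, ← hsol x hx]
      simp only [picard]; ring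
    rw [e, abs_neg]
    calc |∫ t in (0 : ℝ)..x, ((1 - picard m k t) ^ m - y t ^ m)|
        ≤ ∫ t in (0 : ℝ)..x, |(1 - picard m k t) ^ m - y t ^ m| :=
          intervalIntegral.abs_integral_le_integral_abs hx.1
      -- On `[0,1]` the map `a ↦ a^m` is `m`-Lipschitz; integrating the induction hypothesis then
      -- produces the next factorial.
      _ ≤ ∫ t in (0 : ℝ)..x, m * ((m * t) ^ k / k.factorial) := by
          refine intervalIntegral.integral_mono_on hx.1 (hc1.sub hc2).abs
            (Continuous.intervalIntegrable (by fun_prop) 0 x) fun t ht => ?_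
          have ht' : t ∈ Set.Icc (0 : ℝ) 1 := ⟨ht.1, ht.2.trans hx.2⟩
          have h1 := picard_mem m k t ht'
          refine (abs_pow_sub_pow_le_of_mem ⟨?_, ?_⟩ (hy1 t ht') m).trans ?_
          · linarith [h1.2, ht'.2]
          · linarith [h1.1]
          · exact mul_le_mul_of_nonneg_left (ih t ht') (Nat.cast_nonneg m)
      _ = (m * x) ^ (k + 1) / (k + 1).factorial := by
          have : ∀ t : ℝ, m * ((m * t) ^ k / k.factorial) =
              ((m : ℝ) ^ (k + 1) / k.factorial) * t ^ k := by intro t; ring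
          simp only [this]
          rw [intervalIntegral.integral_const_mul, integral_pow, Nat.factorial_succ]
          push_cast
          have := Nat.factorial_ne_zero k
          field_simp
          simp [mul_pow]

/-- The probability that no neighbour of the root of the `d`-regular tree which precedes the root
is occupied after `k` rounds converges to the greedy density. -/
lemma tendsto_integral_picard {d : ℕ} (hd : 3 ≤ d) {c : ℝ}
    (hc : c = 1 / 2 * (1 - ((d : ℝ) - 1) ^ (-2 / ((d : ℝ) - 2)))) :
    Tendsto (fun k => ∫ t in (0 : ℝ)..1, (1 - picard (d - 1) k t) ^ d) atTop (𝓝 c) := by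
  have hd' : (3 : ℝ) ≤ d := by exact_mod_cast hd
  have hb : (0 : ℝ) < d - 2 := by linarith
  -- Separation of variables in `y' = -y^(d-1)`, `y(0) = 1`; thus `1 - y` is the fixed point of the
  -- Picard map with `m = d - 1`.
  set y : ℝ → ℝ := fun x => (1 + (d - 2) * x) ^ (-1 / ((d : ℝ) - 2)) with hy
  have hpos : ∀ x ∈ Set.Icc (0 : ℝ) 1, 0 < 1 + ((d : ℝ) - 2) * x := fun x hx => by
    nlinarith [hx.1]
  have hypos : ∀ x ∈ Set.Icc (0 : ℝ) 1, 0 < y x := fun x hx => Real.rpow_pos_of_pos (hpos x hx) _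
  have hderiv : ∀ x ∈ Set.Icc (0 : ℝ) 1, HasDerivAt y (-(y x ^ (d - 1))) x := by
    intro x hx
    have h1 : HasDerivAt (fun x : ℝ => 1 + ((d : ℝ) - 2) * x) ((d : ℝ) - 2) x := by
      simpa using ((hasDerivAt_id x).const_mul ((d : ℝ) - 2)).const_add 1
    have h2 := h1.rpow_const (p := -1 / ((d : ℝ) - 2)) (Or.inl (hpos x hx).ne')
    convert h2 using 1
    rw [hy]
    simp only
    rw [← Real.rpow_natCast, ← Real.rpow_mul (hpos x hx).le]
    have e1 : -1 / ((d : ℝ) - 2) * ((d - 1 : ℕ) : ℝ) = -1 / ((d : ℝ) - 2) - 1 := by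
      rw [Nat.cast_sub (by omega)]; field_simp; push_cast; ring
    rw [e1]
    field_simp
  have hycont : ContinuousOn y (Set.Icc 0 1) := fun x hx => (hderiv x hx).continuousAt.continuousWithinAt
  have hy1 : ∀ x ∈ Set.Icc (0 : ℝ) 1, y x ∈ Set.Icc (0 : ℝ) 1 := by
    intro x hx
    refine ⟨(hypos x hx).le, Real.rpow_le_one_of_one_le_of_nonpos ?_ ?_⟩
    · nlinarith [hx.1]
    · exact div_nonpos_of_nonpos_of_nonneg (by norm_num) hb.le
  have hy0 : y 0 = 1 := by simp [hy]
  have hsol : ∀ x ∈ Set.Icc (0 : ℝ) 1, 1 - y x = ∫ t in (0 : ℝ)..x, y t ^ (d - 1) := by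
    intro x hx
    have hsub : Set.uIcc 0 x ⊆ Set.Icc (0 : ℝ) 1 := by
      rw [Set.uIcc_of_le hx.1]; exact Set.Icc_subset_Icc le_rfl hx.2
    have := intervalIntegral.integral_eq_sub_of_hasDerivAt (a := 0) (b := x) (f := fun t => -y t)
      (f' := fun t => y t ^ (d - 1)) (fun t ht => by
        simpa using! (hderiv t (hsub ht)).neg)
      ((hycont.mono hsub).pow _).intervalIntegrable
    rw [this, hy0]; ring
  have hu : Set.uIcc (0 : ℝ) 1 = Set.Icc 0 1 := Set.uIcc_of_le zero_le_one
  have hyint : IntervalIntegrable (fun t => y t ^ d) volume 0 1 := by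
    refine ContinuousOn.intervalIntegrable ?_
    rw [hu]; exact hycont.pow d
  have hlim : ∫ t in (0 : ℝ)..1, y t ^ d = c := by
    -- Since `y' = -y^(d-1)`, the derivative of `y²/2` is `-y^d`, so the integral is explicit.
    have := intervalIntegral.integral_eq_sub_of_hasDerivAt (a := 0) (b := 1)
      (f := fun t => -(y t ^ 2 / 2)) (f' := fun t => y t ^ d) (fun t ht => by
        rw [hu] at ht
        have h := (((hderiv t ht).pow 2).div_const 2).neg
        refine h.congr_deriv ?_
        have : y t ^ d = y t ^ (d - 1) * y t := by rw [← pow_succ]; congr 1; omega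
        rw [this]
        simp; ring) hyint
    rw [this, hy0, hc]
    have h1 : y 1 ^ 2 = ((d : ℝ) - 1) ^ (-2 / ((d : ℝ) - 2)) := by
      rw [hy]; simp only
      rw [← Real.rpow_natCast, ← Real.rpow_mul (by linarith)]
      congr 1
      · ring
      · push_cast; ring
    rw [h1]; ring
  rw [← hlim, tendsto_iff_dist_tendsto_zero]
  have hz : Tendsto (fun k : ℕ => d * (((d - 1 : ℕ) : ℝ) ^ k / k.factorial)) atTop (𝓝 0) := by
    simpa using (FloorSemiring.tendsto_pow_div_factorial_atTop ((d - 1 : ℕ) : ℝ)).const_mul (d : ℝ)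
  refine squeeze_zero (fun _ => dist_nonneg) (fun k => ?_) hz
  have hc1 : IntervalIntegrable (fun t => (1 - picard (d - 1) k t) ^ d) volume 0 1 :=
    ((continuous_const.sub (continuous_picard (d - 1) k)).pow d).intervalIntegrable 0 1
  rw [Real.dist_eq, ← intervalIntegral.integral_sub hc1 hyint]
  calc _ ≤ ∫ t in (0 : ℝ)..1, |(1 - picard (d - 1) k t) ^ d - y t ^ d| :=
        intervalIntegral.abs_integral_le_integral_abs zero_le_one
    _ ≤ ∫ _t in (0 : ℝ)..1, d * (((d - 1 : ℕ) : ℝ) ^ k / k.factorial) := by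
        refine intervalIntegral.integral_mono_on zero_le_one (hc1.sub hyint).abs
          (continuous_const.intervalIntegrable 0 1) fun t ht => ?_
        have h1 := picard_mem (d - 1) k t ht
        refine (abs_pow_sub_pow_le_of_mem ⟨?_, ?_⟩ (hy1 t ht) d).trans ?_
        · linarith [h1.2, ht.2]
        · linarith [h1.1]
        · refine mul_le_mul_of_nonneg_left ((abs_picard_sub_le hycont hy1 hsol k t ht).trans ?_)
            (Nat.cast_nonneg d)
          gcongr
          · exact mul_nonneg (Nat.cast_nonneg _) ht.1
          · exact mul_le_of_le_one_right (Nat.cast_nonneg _) ht.2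
    _ = _ := by simp

/-! ### One step of the recursion -/

lemma DependsOn.finset_inf {V ι : Type*} {s : Finset ι}
    {Z : ι → (V → unitInterval) → unitInterval} {S : ι → Set V}
    (hS : ∀ u ∈ s, DependsOn (Z u) (S u)) :
    DependsOn (fun σ => s.inf fun u => Z u σ) (⋃ u ∈ s, S u) := by
  intro σ τ h
  refine Finset.inf_congr rfl fun u hu => hS u hu fun i hi => h i ?_
  exact Set.mem_biUnion hu hi

lemma measurable_finset_inf {V ι : Type*} {s : Finset ι}
    {Z : ι → (V → unitInterval) → unitInterval} (hZ : ∀ u ∈ s, Measurable (Z u)) :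
    Measurable (fun σ => s.inf fun u => Z u σ) := by
  classical
  induction s using Finset.induction_on with
  | empty => simp
  | insert a s ha ih =>
    simp only [Finset.inf_insert]
    exact (hZ a (by simp)).inf (ih fun u hu => hZ u (by simp [hu]))

open ProbabilityTheory in
-- The infimum is at least `t` iff every `Z u` is, and these events are independent because the sets
-- `S u` are disjoint.
lemma measureReal_le_inf {V ι : Type*} (s : Finset ι) (Z : ι → (V → unitInterval) → unitInterval)
    (S : ι → Set V) (hZ : ∀ u ∈ s, Measurable (Z u)) (hS : ∀ u ∈ s, DependsOn (Z u) (S u))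
    (hdisj : (s : Set ι).PairwiseDisjoint S) (t : unitInterval) (p : ℝ)
    (hp : ∀ u ∈ s, (labelMeasure V).real {σ | Z u σ < t} = p) :
    (labelMeasure V).real {σ | t ≤ s.inf fun u => Z u σ} = (1 - p) ^ s.card := by
  classical
  induction s using Finset.induction_on with
  | empty =>
    have : {σ : V → unitInterval | t ≤ (∅ : Finset ι).inf fun u => Z u σ} = Set.univ := by
      ext; simp
    rw [this]; simp
  | insert a s ha ih =>
    have hZs : ∀ u ∈ s, Measurable (Z u) := fun u hu => hZ u (by simp [hu])
    have hSs : ∀ u ∈ s, DependsOn (Z u) (S u) := fun u hu => hS u (by simp [hu])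
    have hd : Disjoint (S a) (⋃ u ∈ s, S u) := by
      rw [Set.disjoint_iUnion₂_right]
      exact fun u hu => hdisj (by simp) (by simp [hu]) (by rintro rfl; exact ha hu)
    have hZa : Measurable (Z a) := hZ a (by simp)
    have h1 := indepFun_of_dependsOn hZa (measurable_finset_inf hZs)
      (hS a (by simp)) (DependsOn.finset_inf hSs) hd
    have h2 := congrArg ENNReal.toReal
      (IndepFun.measure_inter_preimage_eq_mul h1 _ _ (measurableSet_Ici (a := t))
        (measurableSet_Ici (a := t)))
    rw [ENNReal.toReal_mul] at h2
    have e : {σ : V → unitInterval | t ≤ (insert a s).inf fun u => Z u σ} =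
        Z a ⁻¹' Set.Ici t ∩ (fun σ => s.inf fun u => Z u σ) ⁻¹' Set.Ici t := by
      ext σ; simp
    have h3 : (labelMeasure V).real (Z a ⁻¹' Set.Ici t) = 1 - p := by
      rw [← hp a (by simp), ← probReal_compl_eq_one_sub (measurableSet_lt hZa measurable_const)]
      congr 1; ext σ; simp
    rw [e, Measure.real, h2, ← Measure.real, h3, Finset.card_insert_of_notMem ha, pow_succ']
    congr 1
    exact ih hZs hSs (hdisj.subset (by simp)) fun u hu => hp u (by simp [hu])

open ProbabilityTheory in
/-- One step of the greedy recursion at the vertex `v`, when the labels `Z u` of the neighbours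
depend on disjoint sets of labels. -/
lemma measureReal_label_mem_and_le_inf {V ι : Type*} (s : Finset ι)
    (Z : ι → (V → unitInterval) → unitInterval)
    (S : ι → Set V) (hZ : ∀ u ∈ s, Measurable (Z u)) (hS : ∀ u ∈ s, DependsOn (Z u) (S u))
    (hdisj : (s : Set ι).PairwiseDisjoint S) (v : V) (hv : ∀ u ∈ s, v ∉ S u) (F : ℝ → ℝ)
    (hF : ∀ u ∈ s, ∀ t : unitInterval, (labelMeasure V).real {σ | Z u σ < t} = F t)
    {B : Set unitInterval} (hB : MeasurableSet B) :
    (labelMeasure V).real {σ | σ v ∈ B ∧ σ v ≤ s.inf fun u => Z u σ} =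
      ∫ t in B, (1 - F t) ^ s.card := by
  set M : (V → unitInterval) → unitInterval := fun σ => s.inf fun u => Z u σ with hM
  have hMm : Measurable M := measurable_finset_inf hZ
  have hind : IndepFun (fun σ : V → unitInterval => σ v) M (labelMeasure V) := by
    refine indepFun_of_dependsOn (S := {v}) (measurable_pi_apply v) hMm ?_
      (DependsOn.finset_inf hS) ?_
    · intro σ τ h; exact h v rfl
    · simpa using hv
  -- The own label is independent of the infimum over the neighbours, so Fubini lets one fix its
  -- value `t` and integrate.
  have hlaw : (labelMeasure V).map (fun σ => (σ v, M σ)) =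
      (volume : Measure unitInterval).prod ((labelMeasure V).map M) := by
    rw [(indepFun_iff_map_prod_eq_prod_map_map (measurable_pi_apply v).aemeasurable
      hMm.aemeasurable).1 hind]
    congr 1
    exact Measure.infinitePi_map_eval _ v
  set A : Set (unitInterval × unitInterval) := {q | q.1 ∈ B ∧ q.1 ≤ q.2} with hA
  have hAm : MeasurableSet A :=
    (measurable_fst hB).inter
      (isClosed_le continuous_fst continuous_snd).measurableSet
  have e1 : (labelMeasure V).real {σ | σ v ∈ B ∧ σ v ≤ M σ} =
      ((volume : Measure unitInterval).prod ((labelMeasure V).map M)).real A := by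
    rw [← hlaw, map_measureReal_apply ((measurable_pi_apply v).prodMk hMm) hAm]
    rfl
  have hν : IsProbabilityMeasure ((labelMeasure V).map M) :=
    Measure.isProbabilityMeasure_map hMm.aemeasurable
  rw [e1, Measure.real, Measure.prod_apply hAm, ← integral_toReal
    (measurable_measure_prodMk_left hAm).aemeasurable
    (Eventually.of_forall fun _ => measure_lt_top _ _), ← integral_indicator hB]
  refine integral_congr_ae (Eventually.of_forall fun t => ?_)
  by_cases ht : t ∈ B
  · have : Prod.mk t ⁻¹' A = Set.Ici t := by ext; simp [hA, ht]
    simp only [this, Set.indicator_of_mem ht]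
    rw [Measure.map_apply hMm measurableSet_Ici]
    exact measureReal_le_inf s Z S hZ hS hdisj t _ fun u hu => hF u hu t
  · have : Prod.mk t ⁻¹' A = ∅ := by ext; simp [hA, ht]
    simp [this, ht]

lemma setIntegral_Iio_unitInterval (g : ℝ → ℝ) (x : unitInterval) :
    ∫ t in Set.Iio x, g t = ∫ t in (0 : ℝ)..x, g t := by
  have h := integral_subtype_comap (μ := volume) (s := Set.Icc (0 : ℝ) 1) measurableSet_Icc
    ((Set.Iio (x : ℝ)).indicator g)
  rw [intervalIntegral.integral_of_le x.2.1, integral_Ioc_eq_integral_Ioo,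
    ← integral_Ico_eq_integral_Ioo, ← integral_indicator measurableSet_Iio]
  rw [integral_indicator measurableSet_Iio, Measure.restrict_restrict measurableSet_Iio] at h
  have e : Set.Iio (x : ℝ) ∩ Set.Icc 0 1 = Set.Ico 0 (x : ℝ) := by
    ext y
    simp only [Set.mem_inter_iff, Set.mem_Iio, Set.mem_Icc, Set.mem_Ico]
    have := x.2.2
    constructor
    · rintro ⟨h1, h2, -⟩; exact ⟨h2, h1⟩
    · rintro ⟨h1, h2⟩; exact ⟨h2, h1, by linarith⟩
  rw [e] at h
  exact h

lemma integral_unitInterval_eq (g : ℝ → ℝ) :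
    ∫ t : unitInterval, g t = ∫ t in (0 : ℝ)..1, g t := by
  have h := integral_subtype_comap (μ := volume) (s := Set.Icc (0 : ℝ) 1) measurableSet_Icc g
  rw [intervalIntegral.integral_of_le zero_le_one, ← integral_Icc_eq_integral_Ioc]
  exact h

/-! ### Locally tree-like graphs -/

/-- The graph formed by the edges of `G` inside the ball of radius `k` around `ρ`. -/
def ballGraph {V : Type*} (G : SimpleGraph V) (ρ : V) (k : ℕ) : SimpleGraph V where
  Adj a b := G.Adj a b ∧ G.edist ρ a ≤ k ∧ G.edist ρ b ≤ k
  symm := ⟨fun _ _ h => ⟨h.1.symm, h.2.2, h.2.1⟩⟩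
  loopless := ⟨fun _ h => h.1.ne rfl⟩

/-- The vertices reached from `w` by a path whose first step leads to `v`. -/
def branch {V : Type*} (G : SimpleGraph V) (w v : V) : Set V :=
  {z | ∃ (h : G.Adj w v) (p : G.Walk v z), (SimpleGraph.Walk.cons h p).IsPath}

lemma self_mem_branch {V : Type*} {G : SimpleGraph V} {w v : V} (h : G.Adj w v) :
    v ∈ branch G w v := ⟨h, .nil, by simp [h.ne]⟩

lemma notMem_branch {V : Type*} {G : SimpleGraph V} {w v : V} : w ∉ branch G w v := by
  rintro ⟨h, p, hp⟩
  rw [SimpleGraph.Walk.cons_isPath_iff] at hp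
  exact hp.2 p.end_mem_support

/-- In a forest every walk without backtracking is a path, so a path starting along `v u` may be
prefixed by `w` as soon as `u ≠ w`. -/
lemma branch_subset {V : Type*} {G : SimpleGraph V} (hG : G.IsAcyclic) {w v u : V}
    (h : G.Adj w v) (hu : u ≠ w) : branch G v u ⊆ branch G w v := by
  rintro z ⟨h', p, hp⟩
  refine ⟨h, .cons h' p, ?_⟩
  rw [hG.isPath_iff_isChain] at hp ⊢
  rw [SimpleGraph.Walk.edges_cons] at hp
  rw [SimpleGraph.Walk.edges_cons, SimpleGraph.Walk.edges_cons, List.isChain_cons_cons]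
  refine ⟨?_, hp⟩
  intro e
  rw [Sym2.eq_iff] at e
  rcases e with ⟨e, -⟩ | ⟨e, -⟩
  · exact h.ne e
  · exact hu e.symm

/-- Paths between two vertices of a forest are unique, so the endpoint determines the first step. -/
lemma disjoint_branch {V : Type*} {G : SimpleGraph V} (hG : G.IsAcyclic) {v u u' : V}
    (hne : u ≠ u') : Disjoint (branch G v u) (branch G v u') := by
  rw [Set.disjoint_left]
  rintro z ⟨h, p, hp⟩ ⟨h', p', hp'⟩
  have := congrArg Subtype.val ((hG.subsingleton_path v z).elim ⟨_, hp⟩ ⟨_, hp'⟩)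
  have := congrArg SimpleGraph.Walk.snd this
  simp at this
  exact hne this

lemma edist_le_of_adj {V : Type*} {G : SimpleGraph V} {ρ v u : V} (h : G.Adj v u) :
    G.edist ρ u ≤ G.edist ρ v + 1 := by
  refine (SimpleGraph.edist_triangle (v := v)).trans ?_
  rw [SimpleGraph.edist_eq_one_iff_adj.2 h]

lemma measureReal_label_lt {V : Type*} (v : V) (t : unitInterval) :
    (labelMeasure V).real {σ | σ v < t} = t := by
  have h := Measure.infinitePi_map_eval (fun _ : V => (volume : Measure unitInterval)) v
  have : (labelMeasure V).real {σ | σ v < t} = (volume : Measure unitInterval).real (Set.Iio t) := by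
    rw [← h, map_measureReal_apply (measurable_pi_apply v) measurableSet_Iio]
    rfl
  rw [this, Measure.real, unitInterval.volume_Iio]
  exact ENNReal.toReal_ofReal t.2.1

lemma occ_succ_iff_le_inf {V : Type*} [DecidableEq V] {G : SimpleGraph V} [G.LocallyFinite]
    {σ : V → unitInterval} {k : ℕ} {w v : V} :
    occ G σ (k + 1) w v ↔
      σ v ≤ ((G.neighborFinset v).erase w).inf fun u => occLabel G k v u σ := by
  rw [occ_succ_iff, Finset.le_inf_iff]
  refine ⟨fun h u hu => ?_, fun h u hu hw => h u (by simp [hu, hw])⟩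
  simp only [Finset.mem_erase, SimpleGraph.mem_neighborFinset] at hu
  exact h u hu.2 hu.1

lemma occLabel_lt_iff {V : Type*} {G : SimpleGraph V} {σ : V → unitInterval} {k : ℕ} {w v : V}
    {t : unitInterval} : occLabel G k w v σ < t ↔ σ v < t ∧ occ G σ k w v := by
  unfold occLabel
  split_ifs with h
  · simp [h]
  · simp [h, unitInterval.le_one']

/-- The two conclusions are proved together: dependence on the branch makes the `d - 1` children of
`v` independent, and independence yields the next Picard iterate. The bound on `G.edist ρ v + k`
keeps all `k` rounds inside the acyclic ball. -/
lemma occLabel_branch {V : Type*} {G : SimpleGraph V} [G.LocallyFinite] {d : ℕ}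
    (hd : G.IsRegularOfDegree d) {ρ : V} {r : ℕ} (hG : (ballGraph G ρ r).IsAcyclic) (k : ℕ) :
    ∀ w v, G.Adj w v → G.edist ρ w ≤ r → G.edist ρ v + k ≤ r →
      DependsOn (occLabel G k w v) (branch (ballGraph G ρ r) w v) ∧
      ∀ t : unitInterval,
        (labelMeasure V).real {σ | occLabel G k w v σ < t} = picard (d - 1) k t := by
  classical
  induction k with
  | zero =>
    intro w v hwv hw hv
    have hadj : (ballGraph G ρ r).Adj w v := ⟨hwv, hw, by simpa using hv⟩
    have e : occLabel G 0 w v = fun σ => σ v := by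
      funext σ; simp [occLabel, occ]
    refine ⟨?_, fun t => ?_⟩
    · intro σ τ h
      rw [e]
      exact h v (self_mem_branch hadj)
    · rw [e]; exact measureReal_label_lt v t
  | succ k ih =>
    intro w v hwv hw hv
    have hv' : G.edist ρ v ≤ r := le_self_add.trans hv
    have hadj : (ballGraph G ρ r).Adj w v := ⟨hwv, hw, hv'⟩
    have ih' : ∀ u ∈ (G.neighborFinset v).erase w, _ := fun u hu =>
      ih v u (by simpa using (Finset.mem_erase.1 hu).2) hv' <| by
        have h1 := edist_le_of_adj (ρ := ρ) (show G.Adj v u by simpa using (Finset.mem_erase.1 hu).2)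
        refine le_trans (add_le_add_left h1 (k : ℕ∞)) ?_
        rw [add_assoc, add_comm 1 (k : ℕ∞)]
        exact_mod_cast hv
    refine ⟨?_, fun t => ?_⟩
    · intro σ τ h
      have hvv : σ v = τ v := h v (self_mem_branch hadj)
      have hocc : occ G σ (k + 1) w v ↔ occ G τ (k + 1) w v := by
        rw [occ_succ_iff_le_inf, occ_succ_iff_le_inf, hvv]
        refine iff_of_eq (congrArg _ (Finset.inf_congr rfl fun u hu => ?_))
        exact (ih' u hu).1 fun i hi => h i (branch_subset hG hadj (Finset.ne_of_mem_erase hu) hi)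
      simp only [occLabel, hocc, hvv]
    · have e : {σ | occLabel G (k + 1) w v σ < t} = {σ | σ v ∈ Set.Iio t ∧
          σ v ≤ ((G.neighborFinset v).erase w).inf fun u => occLabel G k v u σ} := by
        ext σ
        rw [Set.mem_ofPred_eq, occLabel_lt_iff, occ_succ_iff_le_inf]; rfl
      rw [e, measureReal_label_mem_and_le_inf _ _ (fun u => branch (ballGraph G ρ r) v u)
        (fun u _ => measurable_occLabel G k v u) (fun u hu => (ih' u hu).1)
        (fun u _ u' _ hne => disjoint_branch hG hne) v (fun u _ => notMem_branch)
        (picard (d - 1) k) (fun u hu => (ih' u hu).2) measurableSet_Iio,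
        setIntegral_Iio_unitInterval (fun t => (1 - picard (d - 1) k t) ^ _),
        Finset.card_erase_of_mem (by simpa using hwv.symm), SimpleGraph.card_neighborFinset_eq_degree,
        hd v]
      rfl

/-- The occupation probability of a vertex whose neighbourhood is a tree. -/
lemma measureReal_occ {V : Type*} {G : SimpleGraph V} [G.LocallyFinite] {d : ℕ}
    (hd : G.IsRegularOfDegree d) {ρ : V} {k : ℕ} (hG : (ballGraph G ρ (k + 1)).IsAcyclic) :
    (labelMeasure V).real {σ | occ G σ (k + 1) ρ ρ} =
      ∫ t in (0 : ℝ)..1, (1 - picard (d - 1) k t) ^ d := by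
  classical
  have h : ∀ u ∈ (G.neighborFinset ρ).erase ρ, _ := fun u hu =>
    occLabel_branch hd hG k ρ u (by simpa using (Finset.mem_erase.1 hu).2) (by simp) <| by
      have h1 := edist_le_of_adj (ρ := ρ) (show G.Adj ρ u by simpa using (Finset.mem_erase.1 hu).2)
      rw [SimpleGraph.edist_self, zero_add] at h1
      refine le_trans (add_le_add_left h1 (k : ℕ∞)) ?_
      rw [add_comm]; push_cast; exact le_rfl
  -- The root has no parent: erasing `ρ` removes nothing, so the exponent is `d` rather than `d -
  -- 1`.
  have e : {σ | occ G σ (k + 1) ρ ρ} = {σ : V → unitInterval | σ ρ ∈ Set.univ ∧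
      σ ρ ≤ ((G.neighborFinset ρ).erase ρ).inf fun u => occLabel G k ρ u σ} := by
    ext σ
    simp [occ_succ_iff_le_inf]
  rw [e, measureReal_label_mem_and_le_inf _ _ (fun u => branch (ballGraph G ρ (k + 1)) ρ u)
    (fun u _ => measurable_occLabel G k ρ u) (fun u hu => (h u hu).1)
    (fun u _ u' _ hne => disjoint_branch hG hne) ρ (fun u _ => notMem_branch)
    (picard (d - 1) k) (fun u hu => (h u hu).2) MeasurableSet.univ, setIntegral_univ,
    integral_unitInterval_eq (fun t => (1 - picard (d - 1) k t) ^ _),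
    Finset.erase_eq_of_notMem (by simp), SimpleGraph.card_neighborFinset_eq_degree, hd ρ]

/-! ### Balls -/

lemma edist_le_succ {V : Type*} {G : SimpleGraph V} {ρ z : V} {k : ℕ}
    (h : G.edist ρ z ≤ (k + 1 : ℕ)) : z = ρ ∨ ∃ u, G.Adj ρ u ∧ G.edist u z ≤ k := by
  obtain ⟨p, hp⟩ := SimpleGraph.exists_walk_of_edist_ne_top
    (ne_top_of_le_ne_top (ENat.natCast_ne_top _) h)
  cases p with
  | nil => exact Or.inl rfl
  | @cons _ u _ ha q =>
    refine Or.inr ⟨u, ha, (SimpleGraph.edist_le q).trans ?_⟩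
    rw [← hp, SimpleGraph.Walk.length_cons] at h
    have : q.length + 1 ≤ k + 1 := by exact_mod_cast h
    exact_mod_cast Nat.le_of_succ_le_succ this

/-- A crude bound on the size of balls; any bound depending only on `d` and `k` would serve. -/
lemma exists_finset_ball {V : Type*} {G : SimpleGraph V} [G.LocallyFinite] {d : ℕ}
    (hd : G.IsRegularOfDegree d) (k : ℕ) :
    ∀ ρ, ∃ s : Finset V, s.card ≤ (d + 1) ^ k ∧ ∀ z, G.edist ρ z ≤ k → z ∈ s := by
  classical
  induction k with
  | zero =>
    intro ρ
    refine ⟨{ρ}, by simp, fun z hz => ?_⟩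
    have : ρ = z := SimpleGraph.edist_eq_zero_iff (G := G).1 (nonpos_iff_eq_zero.1 (by exact_mod_cast hz))
    simp [this]
  | succ k ih =>
    intro ρ
    choose s hs hs' using ih
    refine ⟨insert ρ ((G.neighborFinset ρ).biUnion s), ?_, fun z hz => ?_⟩
    · calc _ ≤ ((G.neighborFinset ρ).biUnion s).card + 1 := Finset.card_insert_le _ _
        _ ≤ d * (d + 1) ^ k + 1 := by
            gcongr
            refine (Finset.card_biUnion_le_card_mul _ _ _ fun u _ => hs u).trans_eq ?_
            rw [SimpleGraph.card_neighborFinset_eq_degree, hd ρ]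
        _ ≤ (d + 1) ^ (k + 1) := by
            have : 1 ≤ (d + 1) ^ k := Nat.one_le_pow _ _ (by omega)
            rw [pow_succ]; nlinarith
    · rcases edist_le_succ hz with rfl | ⟨u, hu, huz⟩
      · simp
      · refine Finset.mem_insert_of_mem (Finset.mem_biUnion.2 ⟨u, by simpa using hu, hs' u z huz⟩)

/-- Unlike the dependence on branches, this locality needs no acyclicity; it gives independence of
distant vertices in any graph. -/
lemma dependsOn_occ {V : Type*} {G : SimpleGraph V} (k : ℕ) :
    ∀ w v, DependsOn (fun σ : V → unitInterval => occ G σ k w v) {z | G.edist v z ≤ k} := by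
  induction k with
  | zero => intro w v σ τ _; rfl
  | succ k ih =>
    intro w v σ τ h
    refine pi_congr fun u => ?_
    refine pi_congr fun hu => ?_
    have hv : σ v = τ v := h v (by simp)
    have h1 : G.edist v u ≤ 1 := by rw [SimpleGraph.edist_eq_one_iff_adj.2 hu]
    have huu : σ u = τ u := h u (h1.trans (by norm_cast; omega))
    have : occ G σ k v u = occ G τ k v u := ih v u fun z hz => h z <| by
      refine (SimpleGraph.edist_triangle (v := u)).trans ((add_le_add h1 hz).trans ?_)
      norm_cast; omega
    rw [hv, huu, this]

/-! ### Ordering of labels -/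

lemma ae_label_ne {V : Type*} {u v : V} (h : u ≠ v) : ∀ᵐ σ ∂(labelMeasure V), σ u ≠ σ v := by
  have h1 := Measure.infinitePi_map_eval_prod (P := fun _ : V => (volume : Measure unitInterval)) h
  have hm : Measurable fun σ : V → unitInterval => (σ u, σ v) :=
    (measurable_pi_apply u).prodMk (measurable_pi_apply v)
  have hD : MeasurableSet {q : unitInterval × unitInterval | q.1 = q.2} :=
    (isClosed_eq continuous_fst continuous_snd).measurableSet
  have h2 : ((volume : Measure unitInterval).prod (volume : Measure unitInterval))
      {q : unitInterval × unitInterval | q.1 = q.2} = 0 := by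
    rw [Measure.measure_prod_null hD]
    refine Eventually.of_forall fun x => ?_
    have : Prod.mk x ⁻¹' {q : unitInterval × unitInterval | q.1 = q.2} = {x} := by
      ext y; simp [eq_comm]
    simp [this]
  rw [← h1, Measure.map_apply hm hD] at h2
  rw [ae_iff]
  simpa using! h2

lemma ae_injective_label {V : Type*} [Countable V] :
    ∀ᵐ σ ∂(labelMeasure V), Function.Injective σ := by
  have : ∀ᵐ σ ∂(labelMeasure V), ∀ u v, u ≠ v → σ u ≠ σ v := by
    rw [ae_all_iff]; intro u
    rw [ae_all_iff]; intro v
    by_cases h : u = v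
    · simp [h]
    · filter_upwards [ae_label_ne h] with σ hσ _ using hσ
  filter_upwards [this] with σ hσ u v h
  by_contra hne
  exact hσ u v hne h

lemma measurableSet_strictMono {V : Type*} {m : ℕ} (f : Fin m → V) :
    MeasurableSet {σ : V → unitInterval | StrictMono (σ ∘ f)} := by
  have : {σ : V → unitInterval | StrictMono (σ ∘ f)} =
      ⋂ i, ⋂ j, {σ | i < j → σ (f i) < σ (f j)} := by
    ext σ; simp [StrictMono]
  rw [this]
  refine MeasurableSet.iInter fun i => MeasurableSet.iInter fun j => ?_
  by_cases h : i < j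
  · simpa [h] using measurableSet_lt (measurable_pi_apply (f i)) (measurable_pi_apply (f j))
  · simp [h]

/-- The `m!` events obtained by permuting `f` are equiprobable, because the labels are exchangeable,
and pairwise disjoint. -/
lemma measureReal_strictMono_le {V : Type*} {m : ℕ} {f : Fin m → V} (hf : Function.Injective f) :
    (labelMeasure V).real {σ | StrictMono (σ ∘ f)} ≤ 1 / m.factorial := by
  have hmeas : ∀ {f : Fin m → V}, Function.Injective f →
      (labelMeasure V).real {σ | StrictMono (σ ∘ f)} =
        (labelMeasure (Fin m)).real {σ | StrictMono σ} := by
    intro f hf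
    have hm : MeasurableSet {σ : Fin m → unitInterval | StrictMono σ} := by
      simpa using! measurableSet_strictMono (id : Fin m → Fin m)
    rw [← map_labelMeasure_comp hf, map_measureReal_apply _ hm]
    · rfl
    · exact measurable_pi_iff.2 fun i => measurable_pi_apply _
  have hdisj : Pairwise (Function.onFun Disjoint fun e : Equiv.Perm (Fin m) =>
      {σ : V → unitInterval | StrictMono (σ ∘ (f ∘ e))}) := by
    intro e e' hne
    rw [Function.onFun, Set.disjoint_left]
    intro σ h h'
    refine hne (Equiv.ext fun i => ?_)
    -- Two increasing enumerations of the same set of labels coincide.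
    have hr : Set.range (σ ∘ (f ∘ e)) = Set.range (σ ∘ (f ∘ e')) := by
      rw [← Function.comp_assoc, ← Function.comp_assoc, Set.range_comp, Set.range_comp (σ ∘ f)]
      simp
    have := congrFun (StrictMono.range_inj h h' |>.1 hr) i
    have hinj : Function.Injective (σ ∘ f) := by
      have : σ ∘ f = (σ ∘ (f ∘ e)) ∘ e.symm := by ext; simp
      rw [this]
      exact h.injective.comp e.symm.injective
    exact hinj this
  have hsum := measureReal_biUnion_finset (μ := labelMeasure V) (s := Finset.univ)
    (f := fun e : Equiv.Perm (Fin m) => {σ : V → unitInterval | StrictMono (σ ∘ (f ∘ e))})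
    (fun e _ e' _ h => hdisj h) (fun e _ => measurableSet_strictMono _)
  have h1 : ∀ e : Equiv.Perm (Fin m), (labelMeasure V).real
      {σ : V → unitInterval | StrictMono (σ ∘ (f ∘ e))} =
        (labelMeasure V).real {σ | StrictMono (σ ∘ f)} := fun e => by
    rw [hmeas (hf.comp e.injective), hmeas hf]
  simp only [h1] at hsum
  rw [Finset.sum_const, Finset.card_univ, Fintype.card_perm, Fintype.card_fin, nsmul_eq_mul] at hsum
  rw [le_div_iff₀ (by positivity), mul_comm, ← hsum]
  exact measureReal_le_one

/-! ### Decreasing paths -/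

/-- There is a path of length `k` from `v` along which the labels strictly decrease. -/
def decPath {V : Type*} (G : SimpleGraph V) (σ : V → unitInterval) : ℕ → V → Prop
  | 0, _ => True
  | k + 1, v => ∃ u, G.Adj v u ∧ σ u < σ v ∧ decPath G σ k u

/-- With decreasing paths of bounded length and finitely many neighbours at each step, the past is a
finite union of smaller pasts. -/
lemma finite_past_of_not_decPath {V : Type*} {G : SimpleGraph V} [G.LocallyFinite]
    {σ : V → unitInterval} (k : ℕ) : ∀ v, ¬ decPath G σ k v → (past G σ v).Finite := by
  induction k with
  | zero => intro v h; exact absurd trivial h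
  | succ k ih =>
    intro v h
    have hfin : (⋃ u ∈ {u | u ∈ G.neighborFinset v ∧ σ u < σ v}, past G σ u).Finite := by
      refine Set.Finite.biUnion ((G.neighborFinset v).finite_toSet.subset fun u hu => hu.1) ?_
      rintro u ⟨hu, hlt⟩
      exact ih u fun hd => h ⟨u, by simpa using hu, hlt, hd⟩
    refine (hfin.insert v).subset fun z hz => ?_
    rcases Relation.ReflTransGen.cases_head hz with rfl | ⟨u, ⟨hu, hlt⟩, huz⟩
    · simp
    · refine Set.mem_insert_of_mem _ (Set.mem_biUnion (x := u) ⟨by simpa using hu, hlt⟩ huz)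

/-- The sequences of vertices visited by the walks of length `k` which end at `v`. -/
noncomputable def walkSeq {V : Type*} (G : SimpleGraph V) [G.LocallyFinite] :
    (k : ℕ) → V → Finset (Fin (k + 1) → V)
  | 0, v => {fun _ => v}
  | k + 1, v => open Classical in
      (G.neighborFinset v).biUnion fun u => (walkSeq G k u).image fun f => Fin.snoc f v

lemma card_walkSeq_le {V : Type*} {G : SimpleGraph V} [G.LocallyFinite] {d : ℕ}
    (hd : G.IsRegularOfDegree d) (k : ℕ) : ∀ v, (walkSeq G k v).card ≤ d ^ k := by
  classical
  induction k with
  | zero => intro v; simp [walkSeq]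
  | succ k ih =>
    intro v
    refine (Finset.card_biUnion_le_card_mul _ _ _
      fun u _ => Finset.card_image_le.trans (ih u)).trans_eq ?_
    rw [SimpleGraph.card_neighborFinset_eq_degree, hd v, pow_succ']

/-- The path is read backwards, from its lowest label up to `v`, which turns strict decrease into
`StrictMono`. -/
lemma exists_walkSeq_of_decPath {V : Type*} {G : SimpleGraph V} [G.LocallyFinite]
    {σ : V → unitInterval} (k : ℕ) : ∀ v, decPath G σ k v →
      ∃ f ∈ walkSeq G k v, f (Fin.last k) = v ∧ StrictMono (σ ∘ f) := by
  classical
  induction k with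
  | zero =>
    intro v _
    refine ⟨fun _ => v, by simp [walkSeq], rfl, ?_⟩
    exact fun i j h => absurd h (by have := i.2; have := j.2; simp only [Fin.lt_def]; omega)
  | succ k ih =>
    rintro v ⟨u, hu, hlt, hd⟩
    obtain ⟨f, hf, hfl, hmono⟩ := ih u hd
    refine ⟨Fin.snoc f v, ?_, by simp, ?_⟩
    · simp only [walkSeq, Finset.mem_biUnion, Finset.mem_image]
      exact ⟨u, by simpa using hu, f, hf, rfl⟩
    · rw [Fin.strictMono_iff_lt_succ] at hmono ⊢
      intro i
      refine Fin.lastCases ?_ (fun j => ?_) i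
      · simp [hfl, hlt]
      · have := hmono j
        simp only [Function.comp_apply, Fin.succ_castSucc, Fin.snoc_castSucc]
        exact this

/-- Union bound over at most `d^k` walks, each monotone with probability at most `1/(k+1)!`. -/
lemma measureReal_decPath_le {V : Type*} {G : SimpleGraph V} [G.LocallyFinite] {d : ℕ}
    (hd : G.IsRegularOfDegree d) (k : ℕ) (v : V) :
    (labelMeasure V).real {σ | decPath G σ k v} ≤ d ^ k / (k + 1).factorial := by
  have hsub : {σ | decPath G σ k v} ⊆ ⋃ f ∈ walkSeq G k v, {σ | StrictMono (σ ∘ f)} := by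
    intro σ hσ
    obtain ⟨f, hf, -, hmono⟩ := exists_walkSeq_of_decPath k v hσ
    exact Set.mem_biUnion hf hmono
  have hone : ∀ f : Fin (k + 1) → V,
      (labelMeasure V).real {σ | StrictMono (σ ∘ f)} ≤ 1 / (k + 1).factorial := by
    intro f
    by_cases hf : Function.Injective f
    · exact measureReal_strictMono_le hf
    -- A walk that revisits a vertex cannot have strictly monotone labels.
    · have : {σ : V → unitInterval | StrictMono (σ ∘ f)} = ∅ := by
        ext σ
        simp only [Set.mem_ofPred_eq, Set.mem_empty_iff_false, iff_false]
        exact fun h => hf h.injective.of_comp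
      rw [this]; simp
  calc _ ≤ (labelMeasure V).real (⋃ f ∈ walkSeq G k v, {σ | StrictMono (σ ∘ f)}) :=
        measureReal_mono hsub (measure_ne_top _ _)
    _ ≤ ∑ f ∈ walkSeq G k v, (labelMeasure V).real {σ | StrictMono (σ ∘ f)} :=
        measureReal_biUnion_finset_le _ _
    _ ≤ ∑ _f ∈ walkSeq G k v, (1 : ℝ) / (k + 1).factorial := Finset.sum_le_sum fun f _ => hone f
    _ = (walkSeq G k v).card / (k + 1).factorial := by simp [div_eq_mul_inv]
    _ ≤ _ := by
        gcongr
        exact_mod_cast card_walkSeq_le hd k v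

lemma nonexplosiveGrowth_of_isRegularOfDegree {V : Type*} {G : SimpleGraph V} [G.LocallyFinite]
    {d : ℕ} (hd : G.IsRegularOfDegree d) (v : V) : NonexplosiveGrowth G v := by
  have h0 : (labelMeasure V).real {σ | ¬ (past G σ v).Finite} ≤ 0 := by
    refine ge_of_tendsto (FloorSemiring.tendsto_pow_div_factorial_atTop (d : ℝ))
      (Eventually.of_forall fun k => ?_)
    refine (measureReal_mono fun σ hσ => ?_).trans ((measureReal_decPath_le hd k v).trans ?_)
    · by_contra h
      exact hσ (finite_past_of_not_decPath k v h)
    · gcongr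
      exact Nat.le_succ k
  have := le_antisymm h0 measureReal_nonneg
  rw [measureReal_eq_zero_iff] at this
  exact this

/-! ### The regular tree -/

lemma ballGraph_le {V : Type*} (G : SimpleGraph V) (ρ : V) (k : ℕ) : ballGraph G ρ k ≤ G :=
  fun _ _ h => h.1

/-- Countability is what allows the labels to be almost surely all distinct. -/
lemma countable_of_connected {V : Type*} {G : SimpleGraph V} [G.LocallyFinite] {d : ℕ}
    (hd : G.IsRegularOfDegree d) (hc : G.Connected) (ρ : V) : Countable V := by
  choose s _ hs using fun k => exists_finset_ball hd k ρ
  have : (Set.univ : Set V) ⊆ ⋃ k, (s k : Set V) := by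
    intro z _
    obtain ⟨p, hp⟩ := SimpleGraph.exists_walk_of_edist_ne_top
      (SimpleGraph.edist_ne_top_iff_reachable.2 (hc.preconnected ρ z))
    exact Set.mem_iUnion.2 ⟨p.length, hs _ z hp.ge⟩
  rw [← Set.countable_univ_iff]
  exact (Set.countable_iUnion fun k => (s k).countable_toSet).mono this

lemma mem_labelOrder {W : Type*} [Fintype W] (σ : W → unitInterval) (v : W) :
    v ∈ labelOrder σ := by
  simp [labelOrder]

lemma nodup_labelOrder {W : Type*} [Fintype W] (σ : W → unitInterval) :
    (labelOrder σ).Nodup :=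
  (List.mergeSort_perm _ _).nodup_iff.2 (Finset.nodup_toList _)

lemma pairwise_labelOrder {W : Type*} [Fintype W] (σ : W → unitInterval) :
    (labelOrder σ).Pairwise (fun u v => σ u ≤ σ v) := by
  have := List.pairwise_mergeSort (le := fun u v => decide (σ u ≤ σ v))
    (fun a b c h h' => by simp only [decide_eq_true_eq] at *; exact h.trans h')
    (fun a b => by simpa using le_total (σ a) (σ b)) (Finset.univ : Finset W).toList
  exact this.imp fun h => by simpa using h

/-- The past is closed under passing to smaller neighbours, so the greedy set of the induced
subgraph solves the recursion of `G` itself there. -/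
lemma rootOccupied_sandwich {V : Type*} {G : SimpleGraph V} {σ : V → unitInterval} {ρ : V}
    (hfin : (past G σ ρ).Finite) (hσ : Function.Injective σ) (k : ℕ) :
    (occ G σ (2 * k + 1) ρ ρ → σ ∈ rootOccupied G ρ) ∧
      (σ ∈ rootOccupied G ρ → occ G σ (2 * k) ρ ρ) := by
  let := hfin.fintype
  set I := greedyMIS (G.induce (past G σ ρ)) (labelOrder fun v : past G σ ρ => σ v) with hI
  have hfix := mem_greedyMIS_iff (G := G.induce (past G σ ρ))
    (nodup_labelOrder fun v : past G σ ρ => σ v) (mem_labelOrder _) (pairwise_labelOrder _)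
    (fun u v h e => h.ne (Subtype.ext (hσ e)))
  have hclosed : ∀ v u, v ∈ past G σ ρ → G.Adj v u → σ u < σ v → u ∈ past G σ ρ :=
    fun v u hv hu hlt => Relation.ReflTransGen.tail hv ⟨hu, hlt⟩
  have hroot : σ ∈ rootOccupied G ρ ↔ ∃ h : ρ ∈ past G σ ρ, (⟨ρ, h⟩ : past G σ ρ) ∈ I :=
    ⟨fun ⟨_, h⟩ => ⟨_, h⟩, fun ⟨_, h⟩ => ⟨hfin, h⟩⟩
  have := occ_sandwich (G := G) (σ := σ) (P := fun v => v ∈ past G σ ρ)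
    (J := fun v => ∃ h : v ∈ past G σ ρ, (⟨v, h⟩ : past G σ ρ) ∈ I) hclosed (fun v hv => ?_) k ρ
    Relation.ReflTransGen.refl
  · rw [hroot]; exact this
  · have h1 : (∃ h : v ∈ past G σ ρ, (⟨v, h⟩ : past G σ ρ) ∈ I) ↔
        (⟨v, hv⟩ : past G σ ρ) ∈ I := ⟨fun ⟨_, h⟩ => h, fun h => ⟨hv, h⟩⟩
    rw [h1, hI, hfix]
    constructor
    · rintro H u hu hlt ⟨hm, hmI⟩
      exact H ⟨u, hm⟩ hu hlt hmI
    · intro H u hu hlt hmI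
      exact H u hu hlt ⟨u.2, hmI⟩

lemma greedyDensity_tree {d : ℕ} (hd : 3 ≤ d) {c : ℝ}
    (hc : c = 1 / 2 * (1 - ((d : ℝ) - 1) ^ (-2 / ((d : ℝ) - 2)))) {V : Type*}
    {T : SimpleGraph V} [T.LocallyFinite] (ρ : V) (hT : T.IsTree) (hreg : T.IsRegularOfDegree d) :
    greedyDensity T ρ = c := by
  have hlim := tendsto_integral_picard hd hc
  have := countable_of_connected hreg hT.connected ρ
  have hocc : ∀ k, (labelMeasure V).real {σ | occ T σ (k + 1) ρ ρ} =
      ∫ t in (0 : ℝ)..1, (1 - picard (d - 1) k t) ^ d := fun k =>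
    measureReal_occ hreg (hT.isAcyclic.anti (ballGraph_le T ρ (k + 1)))
  have hae : ∀ᵐ σ ∂(labelMeasure V), (past T σ ρ).Finite ∧ Function.Injective σ :=
    (nonexplosiveGrowth_of_isRegularOfDegree hreg ρ).and ae_injective_label
  -- Almost-everywhere inclusion suffices for arbitrary sets, so measurability of `rootOccupied`
  -- never enters.
  have hmono : ∀ {A B : Set (V → unitInterval)},
      (∀ σ, (past T σ ρ).Finite ∧ Function.Injective σ → σ ∈ A → σ ∈ B) →
      (labelMeasure V).real A ≤ (labelMeasure V).real B := by
    intro A B h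
    refine ENNReal.toReal_mono (measure_ne_top _ _) (measure_mono_ae ?_)
    filter_upwards [hae] with σ hσ using h σ hσ
  refine le_antisymm ?_ ?_
  · refine ge_of_tendsto' (hlim.comp (tendsto_atTop_mono (fun k => (by omega : k ≤ 2 * k + 1))
      tendsto_id)) fun k => ?_
    rw [Function.comp_apply, ← hocc]
    exact hmono fun σ hσ h => (rootOccupied_sandwich hσ.1 hσ.2 (k + 1)).2 h
  · refine le_of_tendsto' (hlim.comp (tendsto_atTop_mono (fun k => (by omega : k ≤ 2 * k))
      tendsto_id)) fun k => ?_
    rw [Function.comp_apply, ← hocc]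
    exact hmono fun σ hσ h => (rootOccupied_sandwich hσ.1 hσ.2 k).1 h

/-! ### Concentration in finite graphs -/

/-- The indicator of the event that `v` is occupied after `k` rounds. -/
noncomputable def occInd {V : Type*} (G : SimpleGraph V) (k : ℕ) (v : V)
    (σ : V → unitInterval) : ℝ :=
  open Classical in if occ G σ k v v then 1 else 0

lemma measurable_occInd {V : Type*} (G : SimpleGraph V) [G.LocallyFinite] (k : ℕ) (v : V) :
    Measurable (occInd G k v) := by
  classical
  unfold occInd
  exact Measurable.ite (measurableSet_occ G k v v) measurable_const measurable_const

lemma occInd_mem {V : Type*} (G : SimpleGraph V) (k : ℕ) (v : V) (σ : V → unitInterval) :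
    occInd G k v σ ∈ Set.Icc (0 : ℝ) 1 := by
  unfold occInd
  split_ifs <;> simp

lemma memLp_occInd {V : Type*} (G : SimpleGraph V) [G.LocallyFinite] (k : ℕ) (v : V) (p : ENNReal) :
    MemLp (occInd G k v) p (labelMeasure V) := by
  refine MemLp.of_bound (measurable_occInd G k v).aestronglyMeasurable 1
    (Eventually.of_forall fun σ => ?_)
  have := occInd_mem G k v σ
  rw [Real.norm_eq_abs, abs_le]
  exact ⟨by linarith [this.1], this.2⟩

lemma integral_occInd {V : Type*} (G : SimpleGraph V) [G.LocallyFinite] (k : ℕ) (v : V) :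
    ∫ σ, occInd G k v σ ∂(labelMeasure V) = (labelMeasure V).real {σ | occ G σ k v v} := by
  classical
  rw [← integral_indicator_one (measurableSet_occ G k v v)]
  refine integral_congr_ae (Eventually.of_forall fun σ => ?_)
  simp [occInd, Set.indicator_apply]

open ProbabilityTheory in
lemma covariance_occInd_le {V : Type*} (G : SimpleGraph V) [G.LocallyFinite] (k : ℕ) (u v : V) :
    cov[occInd G k u, occInd G k v; labelMeasure V] ≤ 1 := by
  rw [covariance_eq_sub (memLp_occInd G k u 2) (memLp_occInd G k v 2)]
  have h0 : ∀ v, 0 ≤ (labelMeasure V)[occInd G k v] := fun v =>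
    integral_nonneg fun σ => (occInd_mem G k v σ).1
  have h1 : (labelMeasure V)[occInd G k u * occInd G k v] ≤ 1 := by
    have : (labelMeasure V)[occInd G k u * occInd G k v] ≤ ∫ _σ, (1 : ℝ) ∂(labelMeasure V) := by
      refine integral_mono_of_nonneg (Eventually.of_forall fun σ => ?_) (integrable_const _)
        (Eventually.of_forall fun σ => ?_)
      · exact mul_nonneg (occInd_mem G k u σ).1 (occInd_mem G k v σ).1
      · exact mul_le_one₀ (occInd_mem G k u σ).2 (occInd_mem G k v σ).1 (occInd_mem G k v σ).2
    simpa using this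
  nlinarith [mul_nonneg (h0 u) (h0 v)]

open ProbabilityTheory in
-- Beyond distance `2k` the balls of radius `k` that determine the two indicators are disjoint.
lemma covariance_occInd_eq_zero {V : Type*} (G : SimpleGraph V) [G.LocallyFinite] (k : ℕ) {u v : V}
    (h : ¬ G.edist u v ≤ (2 * k : ℕ)) :
    cov[occInd G k u, occInd G k v; labelMeasure V] = 0 := by
  refine IndepFun.covariance_eq_zero ?_ (memLp_occInd G k u 2) (memLp_occInd G k v 2)
  have hdep : ∀ v, DependsOn (occInd G k v) {z | G.edist v z ≤ k} := by
    intro v σ τ hστ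
    have : occ G σ k v v = occ G τ k v v := dependsOn_occ k v v hστ
    by_cases hocc : occ G σ k v v
    · have hocc' := this ▸ hocc
      simp [occInd, hocc, hocc']
    · have hocc' := this ▸ hocc
      simp [occInd, hocc, hocc']
  refine indepFun_of_dependsOn (measurable_occInd G k u) (measurable_occInd G k v) (hdep u)
    (hdep v) ?_
  rw [Set.disjoint_left]
  intro z hu hv
  refine h ((SimpleGraph.edist_triangle (v := z)).trans ?_)
  rw [SimpleGraph.edist_comm (u := z)]
  refine (add_le_add hu hv).trans ?_
  rw [two_mul]; push_cast; exact le_rfl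

open ProbabilityTheory in
-- Each vertex is correlated only with vertices in its ball of radius `2k`, so the variance is
-- linear, not quadratic, in the number of vertices.
lemma variance_sum_occInd_le {V : Type*} [Fintype V] {G : SimpleGraph V} [G.LocallyFinite] {d : ℕ}
    (hd : G.IsRegularOfDegree d) (k : ℕ) :
    Var[fun σ => ∑ v, occInd G k v σ; labelMeasure V] ≤
      Fintype.card V * (d + 1) ^ (2 * k) := by
  classical
  rw [variance_fun_sum fun v => memLp_occInd G k v 2]
  have : ∀ u, ∑ v, cov[occInd G k u, occInd G k v; labelMeasure V] ≤ (d + 1) ^ (2 * k) := by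
    intro u
    obtain ⟨s, hs, hs'⟩ := exists_finset_ball hd (2 * k) u
    rw [← Finset.sum_subset (Finset.subset_univ s) fun v _ hv =>
      covariance_occInd_eq_zero G k fun h => hv (hs' v h)]
    calc _ ≤ ∑ _v ∈ s, (1 : ℝ) := Finset.sum_le_sum fun v _ => covariance_occInd_le G k u v
      _ = s.card := by simp
      _ ≤ _ := by exact_mod_cast hs
  calc _ ≤ ∑ _u : V, ((d : ℝ) + 1) ^ (2 * k) := Finset.sum_le_sum fun u _ => this u
    _ = _ := by simp

open ProbabilityTheory in
lemma measureReal_deviation_le {V : Type*} [Fintype V] {G : SimpleGraph V} [G.LocallyFinite]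
    {d : ℕ} (hd : G.IsRegularOfDegree d) (k : ℕ) {ε : ℝ} (hε : 0 < ε)
    (hn : 0 < (Fintype.card V : ℝ)) :
    (labelMeasure V).real {σ | ε * Fintype.card V ≤ |∑ v, occInd G k v σ -
      ∑ v, (labelMeasure V).real {σ | occ G σ k v v}|} ≤
      (d + 1) ^ (2 * k) / ε ^ 2 / Fintype.card V := by
  have hL : MemLp (fun σ => ∑ v, occInd G k v σ) 2 (labelMeasure V) :=
    memLp_finsetSum _ fun v _ => memLp_occInd G k v 2
  have h := meas_ge_le_variance_div_sq hL (mul_pos hε hn)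
  have hint : (labelMeasure V)[fun σ => ∑ v, occInd G k v σ] =
      ∑ v, (labelMeasure V).real {σ | occ G σ k v v} := by
    rw [integral_finsetSum _ fun v _ => (memLp_occInd G k v 1).integrable le_rfl]
    exact Finset.sum_congr rfl fun v _ => integral_occInd G k v
  rw [hint] at h
  have h2 := ENNReal.toReal_mono ENNReal.ofReal_ne_top h
  rw [ENNReal.toReal_ofReal (div_nonneg (variance_nonneg _ _) (sq_nonneg _))] at h2
  refine h2.trans ?_
  rw [div_div, div_le_div_iff₀ (by positivity) (by positivity)]
  calc _ ≤ (Fintype.card V * ((d : ℝ) + 1) ^ (2 * k)) * (ε ^ 2 * Fintype.card V) := by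
        gcongr; exact variance_sum_occInd_le hd k
    _ = _ := by ring

/-! ### Uniformly random orderings -/

lemma exists_vertexOrder {V : Type*} [Fintype V] {σ : V → unitInterval}
    (hσ : Function.Injective σ) : ∃ π : VertexOrder V, StrictMono (σ ∘ π) := by
  set e := (Fintype.equivFin V).symm
  refine ⟨(Tuple.sort (σ ∘ e)).trans e, ?_⟩
  have := (Tuple.monotone_sort (σ ∘ e)).strictMono_of_injective
    ((hσ.comp e.injective).comp (Equiv.injective _))
  exact this

lemma natCard_vertexOrder (V : Type*) [Fintype V] :
    Nat.card (VertexOrder V) = (Fintype.card V).factorial := by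
  classical
  rw [Nat.card_eq_fintype_card, Fintype.card_equiv (Fintype.equivFin V).symm, Fintype.card_fin]

/-- Almost every labelling induces a unique ordering. For this inequality, an upper bound `1/n!` on
the probability of each ordering is enough. -/
lemma measureReal_le_uniformProb {V : Type*} [Fintype V] {Q : Set (V → unitInterval)}
    {p : VertexOrder V → Prop}
    (h : ∀ σ ∈ Q, Function.Injective σ → ∀ π : VertexOrder V, StrictMono (σ ∘ π) → p π) :
    (labelMeasure V).real Q ≤ uniformProb (VertexOrder V) p := by
  classical
  set s : Finset (VertexOrder V) := Finset.univ.filter p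
  have hae : Q ≤ᵐ[labelMeasure V] ⋃ π ∈ s, {σ : V → unitInterval | StrictMono (σ ∘ π)} := by
    filter_upwards [ae_injective_label (V := V)] with σ hσ hQ
    obtain ⟨π, hπ⟩ := exists_vertexOrder hσ
    exact Set.mem_biUnion (x := π) (by simpa [s] using h σ hQ hσ π hπ) hπ
  calc (labelMeasure V).real Q
      ≤ (labelMeasure V).real (⋃ π ∈ s, {σ : V → unitInterval | StrictMono (σ ∘ π)}) :=
        ENNReal.toReal_mono (measure_ne_top _ _) (measure_mono_ae hae)
    _ ≤ ∑ π ∈ s, (labelMeasure V).real {σ : V → unitInterval | StrictMono (σ ∘ π)} :=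
        measureReal_biUnion_finset_le _ _
    _ ≤ ∑ _π ∈ s, (1 : ℝ) / (Fintype.card V).factorial :=
        Finset.sum_le_sum fun π _ => measureReal_strictMono_le π.injective
    _ = uniformProb (VertexOrder V) p := by
        rw [uniformProb, natCard_vertexOrder, Nat.card_eq_fintype_card, Fintype.card_subtype]
        simp [s, div_eq_mul_inv]

lemma greedyMIS_ofFn_sandwich {V : Type*} [Fintype V] {G : SimpleGraph V} {σ : V → unitInterval}
    {π : VertexOrder V} (hπ : StrictMono (σ ∘ π)) (hσ : Function.Injective σ) (k : ℕ) (v : V) :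
    (occ G σ (2 * k + 1) v v → v ∈ greedyMIS G (List.ofFn π)) ∧
      (v ∈ greedyMIS G (List.ofFn π) → occ G σ (2 * k) v v) := by
  refine occ_sandwich (P := fun _ => True) (J := fun v => v ∈ greedyMIS G (List.ofFn π))
    (fun _ _ _ _ _ => trivial) (fun v _ => ?_) k v trivial
  refine mem_greedyMIS_iff (List.nodup_ofFn.2 π.injective) (fun v => ?_) ?_
    (fun u v h e => h.ne (hσ e)) v
  · rw [List.mem_ofFn]; exact ⟨π.symm v, by simp⟩
  · rw [List.pairwise_ofFn]; exact fun i j h => (hπ h).le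

lemma sum_occInd_le_card_mul_greedyRatio {V : Type*} [Fintype V] {G : SimpleGraph V}
    {σ : V → unitInterval} {π : VertexOrder V} (hπ : StrictMono (σ ∘ π))
    (hσ : Function.Injective σ) (k : ℕ) (hn : 0 < (Fintype.card V : ℝ)) :
    ∑ v, occInd G (2 * k + 1) v σ ≤ greedyRatio G π * Fintype.card V ∧
      greedyRatio G π * Fintype.card V ≤ ∑ v, occInd G (2 * k) v σ := by
  classical
  have h1 : greedyRatio G π * Fintype.card V =
      ∑ v, if v ∈ greedyMIS G (List.ofFn π) then (1 : ℝ) else 0 := by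
    rw [greedyRatio, div_mul_cancel₀ _ hn.ne', Finset.sum_boole, Set.ncard_eq_toFinset_card']
    congr 2
    ext v; simp
  rw [h1]
  constructor
  · refine Finset.sum_le_sum fun v _ => ?_
    have := (greedyMIS_ofFn_sandwich (G := G) hπ hσ k v).1
    unfold occInd
    split_ifs <;> simp_all
  · refine Finset.sum_le_sum fun v _ => ?_
    have := (greedyMIS_ofFn_sandwich (G := G) hπ hσ k v).2
    unfold occInd
    split_ifs <;> simp_all

/-! ### Locally tree-like finite graphs -/

/-- The number of vertices whose neighbourhood of radius `r` contains a cycle. -/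
noncomputable def cyclicCount {V : Type*} (G : SimpleGraph V) (r : ℕ) : ℕ :=
  Nat.card {v // ¬ (ballGraph G v r).IsAcyclic}

lemma ballGraph_mono {V : Type*} (G : SimpleGraph V) (ρ : V) {k l : ℕ} (h : k ≤ l) :
    ballGraph G ρ k ≤ ballGraph G ρ l :=
  fun _ _ hab => ⟨hab.1, hab.2.1.trans (by exact_mod_cast h), hab.2.2.trans (by exact_mod_cast h)⟩

lemma cyclicCount_mono {V : Type*} [Finite V] (G : SimpleGraph V) {k l : ℕ} (h : k ≤ l) :
    cyclicCount G k ≤ cyclicCount G l :=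
  Nat.card_le_card_of_injective
    (Subtype.map id fun v hv hac => hv (hac.anti (ballGraph_mono G v h)))
    (Subtype.map_injective _ Function.injective_id)

/-- Vertices with acyclic balls contribute exactly `q`; each of the others costs at most 1. -/
lemma abs_sum_measureReal_occ_sub_le {V : Type*} [Fintype V] {G : SimpleGraph V} [G.LocallyFinite]
    {d : ℕ} (hd : G.IsRegularOfDegree d) (k : ℕ) {q : ℝ}
    (hq : ∫ t in (0 : ℝ)..1, (1 - picard (d - 1) k t) ^ d = q) (hq0 : q ∈ Set.Icc (0 : ℝ) 1) :
    |∑ v, (labelMeasure V).real {σ | occ G σ (k + 1) v v} - Fintype.card V * q| ≤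
      cyclicCount G (k + 1) := by
  classical
  have e : (Fintype.card V : ℝ) * q = ∑ _v : V, q := by simp
  rw [e, ← Finset.sum_sub_distrib]
  refine (Finset.abs_sum_le_sum_abs _ _).trans ?_
  have e2 : (cyclicCount G (k + 1) : ℝ) =
      ∑ v : V, if ¬ (ballGraph G v (k + 1)).IsAcyclic then (1 : ℝ) else 0 := by
    rw [Finset.sum_boole, cyclicCount, Nat.card_eq_fintype_card, Fintype.card_subtype]
  rw [e2]
  refine Finset.sum_le_sum fun v _ => ?_
  by_cases h : (ballGraph G v (k + 1)).IsAcyclic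
  · rw [measureReal_occ hd h, hq]; simp [h]
  · have h1 : (labelMeasure V).real {σ | occ G σ (k + 1) v v} ≤ 1 := measureReal_le_one
    have h2 : 0 ≤ (labelMeasure V).real {σ | occ G σ (k + 1) v v} := measureReal_nonneg
    rw [if_pos h, abs_le]
    constructor <;> linarith [hq0.1, hq0.2]

lemma integral_picard_mem (m d k : ℕ) :
    ∫ t in (0 : ℝ)..1, (1 - picard m k t) ^ d ∈ Set.Icc (0 : ℝ) 1 := by
  have hmem : ∀ t ∈ Set.Icc (0 : ℝ) 1, (1 - picard m k t) ^ d ∈ Set.Icc (0 : ℝ) 1 := by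
    intro t ht
    have := picard_mem m k t ht
    have h1 : 0 ≤ 1 - picard m k t := by linarith [this.2, ht.2]
    exact ⟨pow_nonneg h1 d, pow_le_one₀ h1 (by linarith [this.1])⟩
  have hc : Continuous fun t => (1 - picard m k t) ^ d :=
    (continuous_const.sub (continuous_picard m k)).pow d
  refine ⟨intervalIntegral.integral_nonneg zero_le_one fun t ht => (hmem t ht).1, ?_⟩
  calc _ ≤ ∫ _t in (0 : ℝ)..1, (1 : ℝ) :=
        intervalIntegral.integral_mono_on zero_le_one (hc.intervalIntegrable 0 1)
          (continuous_const.intervalIntegrable 0 1) fun t ht => (hmem t ht).2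
    _ = 1 := by simp

/-- In a regular graph in which few vertices are close to a cycle, the greedy independence ratio
is concentrated. -/
lemma exists_uniformProb_ge {d : ℕ} (hd : 3 ≤ d) {c : ℝ}
    (hc : c = 1 / 2 * (1 - ((d : ℝ) - 1) ^ (-2 / ((d : ℝ) - 2)))) {ε : ℝ} (hε : 0 < ε) :
    ∃ (r : ℕ) (C : ℝ), ∀ (V : Type*) [Fintype V] [Nonempty V] (G : SimpleGraph V) [G.LocallyFinite],
      G.IsRegularOfDegree d → (cyclicCount G r : ℝ) ≤ ε / 4 * Fintype.card V →
        1 - C / Fintype.card V ≤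
          uniformProb (VertexOrder V) (fun π => |greedyRatio G π - c| < ε) := by
  have hlim := tendsto_integral_picard hd hc
  rw [Metric.tendsto_atTop] at hlim
  obtain ⟨k, hk⟩ := hlim (ε / 4) (by positivity)
  -- Rounds `2k+1` and `2k+2` supply the lower and upper bound; `C` adds their Chebyshev constants.
  -- Cycles, distance to the limit and fluctuation each cost `ε/4`, leaving slack below `ε`. Neither
  -- constant depends on the graph.
  refine ⟨2 * k + 2, ((d : ℝ) + 1) ^ (2 * (2 * k + 1)) / (ε / 4) ^ 2 +
    ((d : ℝ) + 1) ^ (2 * (2 * k + 2)) / (ε / 4) ^ 2, ?_⟩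
  intro V _ _ G _ hreg hbad
  have hn : 0 < (Fintype.card V : ℝ) := by exact_mod_cast Fintype.card_pos
  set n : ℝ := (Fintype.card V : ℝ)
  set E : ℕ → ℝ := fun k => ∑ v, (labelMeasure V).real {σ | occ G σ k v v} with hE
  set D : ℕ → Set (V → unitInterval) := fun k =>
    {σ | ε / 4 * n ≤ |∑ v, occInd G k v σ - E k|} with hD
  have hDle : ∀ k, (labelMeasure V).real (D k) ≤ (d + 1) ^ (2 * k) / (ε / 4) ^ 2 / n := fun k =>
    measureReal_deviation_le hreg k (by positivity) hn
  have hEle : ∀ j, k ≤ j → j + 1 ≤ 2 * k + 2 → |E (j + 1) - n * c| ≤ ε / 2 * n := by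
    intro j hj hj'
    have h1 := abs_sum_measureReal_occ_sub_le hreg j rfl (integral_picard_mem (d - 1) d j)
    have h2 : (cyclicCount G (j + 1) : ℝ) ≤ cyclicCount G (2 * k + 2) := by
      exact_mod_cast cyclicCount_mono G hj'
    have h3 := (hk j hj).le
    rw [Real.dist_eq] at h3
    set q := ∫ t in (0 : ℝ)..1, (1 - picard (d - 1) j t) ^ d
    have h4 : |n * q - n * c| ≤ ε / 4 * n := by
      rw [← mul_sub, abs_mul, abs_of_pos hn, mul_comm]; gcongr
    calc |E (j + 1) - n * c| ≤ |E (j + 1) - n * q| + |n * q - n * c| := abs_sub_le _ _ _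
      _ ≤ _ := by linarith
  have hQ := measureReal_le_uniformProb (Q := (D (2 * k + 1) ∪ D (2 * k + 2))ᶜ)
    (p := fun π => |greedyRatio G π - c| < ε) (fun σ hσ hinj π hπ => ?_)
  · refine le_trans ?_ hQ
    have hm : ∀ k, MeasurableSet (D k) := fun k =>
      measurableSet_le measurable_const ((Finset.measurable_fun_sum _ fun v _ =>
        measurable_occInd G k v).sub_const _).abs
    rw [probReal_compl_eq_one_sub ((hm _).union (hm _)), add_div]
    have := measureReal_union_le (μ := labelMeasure V) (D (2 * k + 1)) (D (2 * k + 2))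
    have h1 := hDle (2 * k + 1)
    have h2 := hDle (2 * k + 2)
    linarith
  · simp only [hD, Set.compl_union, Set.mem_inter_iff, Set.mem_compl_iff, Set.mem_ofPred_eq,
      not_le] at hσ
    have h1 := (sum_occInd_le_card_mul_greedyRatio (G := G) hπ hinj k hn).1
    have h2 := (sum_occInd_le_card_mul_greedyRatio (G := G) hπ hinj (k + 1) hn).2
    have h3 := hEle (2 * k) (by omega) (by omega)
    have h4 := hEle (2 * k + 1) (by omega) (by omega)
    have h5 := hσ.1
    have h6 := hσ.2
    rw [abs_le] at h3 h4
    rw [abs_lt] at h5 h6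
    have h7 : 2 * (k + 1) = 2 * k + 2 := by ring
    rw [h7] at h2
    have h8 : 2 * k + 1 + 1 = 2 * k + 2 := by ring
    rw [h8] at h4
    have hl : (c - ε) * n < greedyRatio G π * n := by nlinarith [mul_pos hε hn]
    have hu : greedyRatio G π * n < (c + ε) * n := by nlinarith [mul_pos hε hn]
    have hl' := lt_of_mul_lt_mul_right hl hn.le
    have hu' := lt_of_mul_lt_mul_right hu hn.le
    rw [abs_lt]
    constructor <;> linarith

/-! ### Switchings in regular graphs -/

/-- The graph obtained from `G` by replacing the edges `xy` and `uv` by `xu` and `yv`. -/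
def switching {V : Type*} (G : SimpleGraph V) (x y u v : V) : SimpleGraph V :=
  SimpleGraph.fromEdgeSet ((G.edgeSet \ {s(x, y), s(u, v)}) ∪ {s(x, u), s(y, v)})

/-- The conditions under which replacing the edges `xy` and `uv` by `xu` and `yv` yields a simple
graph with the same degrees. -/
structure Switchable {V : Type*} (G : SimpleGraph V) (x y u v : V) : Prop where
  adj_xy : G.Adj x y
  adj_uv : G.Adj u v
  ne_xu : x ≠ u
  not_adj_xu : ¬ G.Adj x u
  ne_yv : y ≠ v
  not_adj_yv : ¬ G.Adj y v

/-- Together with `ne_yu` and the conditions of `Switchable`, this makes the four vertices pairwise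
distinct. -/
lemma Switchable.ne_xv {V : Type*} {G : SimpleGraph V} {x y u v : V} (h : Switchable G x y u v) :
    x ≠ v := by
  rintro rfl
  exact h.not_adj_yv h.adj_xy.symm

lemma Switchable.ne_yu {V : Type*} {G : SimpleGraph V} {x y u v : V} (h : Switchable G x y u v) :
    y ≠ u := by
  rintro rfl
  exact h.not_adj_xu h.adj_xy

lemma Switchable.edgeSet_switching {V : Type*} {G : SimpleGraph V} {x y u v : V}
    (h : Switchable G x y u v) :
    (switching G x y u v).edgeSet =
      (G.edgeSet \ {s(x, y), s(u, v)}) ∪ {s(x, u), s(y, v)} := by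
  rw [switching, SimpleGraph.edgeSet_fromEdgeSet, sdiff_eq_left, Set.disjoint_left]
  rintro e (⟨he, -⟩ | rfl | rfl) hd
  · exact G.not_isDiag_of_mem_edgeSet he hd
  · exact h.ne_xu (by simpa using hd)
  · exact h.ne_yv (by simpa using hd)

/-- At `x` and `v` the switching exchanges the neighbours `y` and `u`; at `y` and `u` it exchanges
`x` and `v`. Each neighbourhood changes by a permutation, so degrees are preserved. -/
lemma Switchable.adj_switching {V : Type*} [DecidableEq V] {G : SimpleGraph V} {x y u v : V}
    (h : Switchable G x y u v) (a b : V) :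
    (switching G x y u v).Adj a b ↔ G.Adj a
      ((if a = x ∨ a = v then Equiv.swap y u else if a = y ∨ a = u then Equiv.swap x v else 1) b) := by
  have h1 := h.ne_xv
  have h2 := h.ne_yu
  obtain ⟨h3, h4, h5, h6, h7, h8⟩ := h
  have h9 := h3.ne
  have h10 := h4.ne
  have h3' := h3.symm
  have h4' := h4.symm
  have h6' : ¬ G.Adj u x := fun h => h6 h.symm
  have h8' : ¬ G.Adj v y := fun h => h8 h.symm
  rw [← SimpleGraph.mem_edgeSet, Switchable.edgeSet_switching ⟨h3, h4, h5, h6, h7, h8⟩]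
  simp only [Set.mem_union, Set.mem_sdiff, SimpleGraph.mem_edgeSet, Set.mem_insert_iff,
    Set.mem_singleton_iff, Sym2.eq_iff]
  have hsymm : ∀ a b, G.Adj a b → G.Adj b a := fun _ _ h => h.symm
  have hl : ∀ a, ¬ G.Adj a a := fun a h => h.ne rfl
  split_ifs with ha ha'
  · rw [Equiv.swap_apply_def]
    grind
  · rw [Equiv.swap_apply_def]
    grind
  · simp only [Equiv.Perm.one_apply]
    grind

lemma Switchable.ncard_neighborSet {V : Type*} {G : SimpleGraph V} {x y u v : V}
    (h : Switchable G x y u v) (a : V) :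
    ((switching G x y u v).neighborSet a).ncard = (G.neighborSet a).ncard := by
  classical
  obtain ⟨τ, hτ⟩ : ∃ τ : Equiv.Perm V, τ = if a = x ∨ a = v then Equiv.swap y u else
    if a = y ∨ a = u then Equiv.swap x v else 1 := ⟨_, rfl⟩
  have : (switching G x y u v).neighborSet a = τ ⁻¹' (G.neighborSet a) := by
    ext b
    rw [hτ]
    exact h.adj_switching a b
  rw [this, ← Equiv.image_symm_eq_preimage, Set.ncard_image_of_injective _ (Equiv.injective _)]

/-- The switching can be undone once the four vertices are known; this gives injectivity in the
double count. -/
lemma Switchable.edgeSet_eq {V : Type*} {G : SimpleGraph V} {x y u v : V}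
    (h : Switchable G x y u v) :
    G.edgeSet = ((switching G x y u v).edgeSet \ {s(x, u), s(y, v)}) ∪ {s(x, y), s(u, v)} := by
  rw [h.edgeSet_switching]
  have h1 : s(x, y) ∈ G.edgeSet := h.adj_xy
  have h2 : s(u, v) ∈ G.edgeSet := h.adj_uv
  have h3 : s(x, u) ∉ G.edgeSet := h.not_adj_xu
  have h4 : s(y, v) ∉ G.edgeSet := h.not_adj_yv
  ext e
  simp only [Set.mem_union, Set.mem_sdiff, Set.mem_insert_iff, Set.mem_singleton_iff]
  grind

open Classical in
/-- The `d`-regular graphs which contain all edges of the set `F`. -/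
noncomputable def regularContaining (V : Type*) [Fintype V] (d : ℕ) (F : Finset (Sym2 V)) :
    Finset (SimpleGraph V) :=
  Finset.univ.filter fun G => (∀ v, (G.neighborSet v).ncard = d) ∧ ∀ e ∈ F, e ∈ G.edgeSet

lemma mem_regularContaining {V : Type*} [Fintype V] {d : ℕ} {F : Finset (Sym2 V)}
    {G : SimpleGraph V} :
    G ∈ regularContaining V d F ↔
      (∀ v, (G.neighborSet v).ncard = d) ∧ ∀ e ∈ F, e ∈ G.edgeSet := by
  simp [regularContaining]

lemma card_filter_sym2_mem_le {V : Type*} [Fintype V] [DecidableEq V] (F : Finset (Sym2 V)) :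
    (Finset.univ.filter fun q : V × V => s(q.1, q.2) ∈ F).card ≤ F.card * 2 := by
  have : (Finset.univ.filter fun q : V × V => s(q.1, q.2) ∈ F) =
      F.biUnion fun e => Finset.univ.filter fun q : V × V => s(q.1, q.2) = e := by
    ext q; simp
  rw [this]
  refine Finset.card_biUnion_le_card_mul _ _ _ fun e _ => ?_
  induction e using Sym2.ind with
  | _ a b =>
    refine (Finset.card_le_card (t := {(a, b), (b, a)}) fun q hq => ?_).trans Finset.card_le_two
    simp only [Finset.mem_filter, Finset.mem_univ, true_and, Sym2.eq_iff] at hq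
    simp only [Finset.mem_insert, Finset.mem_singleton, Prod.ext_iff]
    exact hq

open Classical in
/-- Most edges of a regular graph can be used to switch away a given edge `xy`. -/
lemma card_switchable_ge {V : Type*} [Fintype V] {d : ℕ} {G : SimpleGraph V}
    (hG : ∀ v, (G.neighborSet v).ncard = d) {x y : V} (hxy : G.Adj x y) (F : Finset (Sym2 V)) :
    d * Fintype.card V ≤ (Finset.univ.filter fun q : V × V =>
      Switchable G x y q.1 q.2 ∧ s(q.1, q.2) ∉ F).card + (2 * d * (d + 1) + F.card * 2) := by
  have hdeg : ∀ v, (G.neighborFinset v).card = d := fun v => by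
    rw [← hG v, Set.ncard_eq_toFinset_card']; rfl
  have hins : ∀ v, (insert v (G.neighborFinset v)).card ≤ d + 1 := fun v =>
    (Finset.card_insert_le _ _).trans (by rw [hdeg])
  have hA : ∀ s : Finset V, (s.sigma fun u => G.neighborFinset u).card = s.card * d := fun s => by
    rw [Finset.card_sigma, Finset.sum_congr rfl fun u _ => hdeg u]; simp
  have hD : (Finset.univ.filter fun q : V × V => G.Adj q.1 q.2).card = d * Fintype.card V := by
    rw [mul_comm, ← Finset.card_univ, ← hA]
    refine Finset.card_nbij' (fun q => ⟨q.1, q.2⟩) (fun q => (q.1, q.2)) ?_ ?_ ?_ ?_ <;>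
      · intro q; simp
  have hx : ((insert x (G.neighborFinset x)).sigma fun u => G.neighborFinset u).card ≤
      d * (d + 1) := by
    rw [hA, mul_comm]; exact Nat.mul_le_mul_left d (hins x)
  have hy : ((insert y (G.neighborFinset y)).sigma fun u => G.neighborFinset u).card ≤
      d * (d + 1) := by
    rw [hA, mul_comm]; exact Nat.mul_le_mul_left d (hins y)
  -- `A` holds the oriented edges whose tail is `x` or adjacent to `x`, and `B` those whose head is
  -- `y` or adjacent to `y`. Apart from orientations of edges in `F`, these are the only ones that
  -- cannot be used.
  set A := ((insert x (G.neighborFinset x)).sigma fun u => G.neighborFinset u).image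
    fun q => (q.1, q.2)
  set B := ((insert y (G.neighborFinset y)).sigma fun u => G.neighborFinset u).image
    fun q => (q.2, q.1)
  have hsub : (Finset.univ.filter fun q : V × V => G.Adj q.1 q.2) ⊆
      (Finset.univ.filter fun q : V × V => Switchable G x y q.1 q.2 ∧ s(q.1, q.2) ∉ F) ∪
        (A ∪ B ∪ Finset.univ.filter fun q : V × V => s(q.1, q.2) ∈ F) := by
    rintro ⟨u, v⟩ h
    simp only [Finset.mem_filter, Finset.mem_univ, true_and] at h
    by_contra hn
    simp only [Finset.mem_union, Finset.mem_filter, Finset.mem_univ, true_and, not_or, not_and,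
      not_not] at hn
    obtain ⟨h1, ⟨h2, h3⟩, h4⟩ := hn
    have h2' : ¬ (u = x ∨ G.Adj x u) := fun hu => h2 <| by
      simp only [A, Finset.mem_image, Finset.mem_sigma, Finset.mem_insert,
        SimpleGraph.mem_neighborFinset]
      exact ⟨⟨u, v⟩, ⟨hu, h⟩, rfl⟩
    have h3' : ¬ (v = y ∨ G.Adj y v) := fun hv => h3 <| by
      simp only [B, Finset.mem_image, Finset.mem_sigma, Finset.mem_insert,
        SimpleGraph.mem_neighborFinset]
      exact ⟨⟨v, u⟩, ⟨hv, h.symm⟩, rfl⟩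
    rw [not_or] at h2' h3'
    exact h4 (h1 ⟨hxy, h, fun e => h2'.1 e.symm, h2'.2, fun e => h3'.1 e.symm, h3'.2⟩)
  rw [← hD]
  refine (Finset.card_le_card hsub).trans ((Finset.card_union_le _ _).trans ?_)
  gcongr
  refine (Finset.card_union_le _ _).trans ?_
  refine add_le_add ((Finset.card_union_le _ _).trans ?_) (card_filter_sym2_mem_le F)
  have h1 : A.card ≤ d * (d + 1) := Finset.card_image_le.trans hx
  have h2 : B.card ≤ d * (d + 1) := Finset.card_image_le.trans hy
  calc A.card + B.card ≤ d * (d + 1) + d * (d + 1) := add_le_add h1 h2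
    _ = _ := by ring

/-- Switching an edge away: few regular graphs containing `F` contain a further given edge. -/
lemma card_regularContaining_insert_mul_le {V : Type*} [Fintype V] [DecidableEq V] (d : ℕ) (x y : V)
    (F : Finset (Sym2 V)) (hF : s(x, y) ∉ F) :
    (regularContaining V d (insert s(x, y) F)).card * (d * Fintype.card V) ≤
      (regularContaining V d F).card * (d * d) +
      (regularContaining V d (insert s(x, y) F)).card * (2 * d * (d + 1) + F.card * 2) := by
  classical
  set R := regularContaining V d (insert s(x, y) F) with hR
  -- Double counting of switchings. `P` lists those that remove `xy` and keep `F`; each is recovered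
  -- from its result and the pair `(u, v)`, for which the result offers only `d * d` choices,
  -- neighbours of `x` and of `y`.
  set P := R.sigma fun G => Finset.univ.filter fun q : V × V =>
    Switchable G x y q.1 q.2 ∧ s(q.1, q.2) ∉ F with hP
  set P' := (regularContaining V d F).sigma fun G =>
    G.neighborFinset x ×ˢ G.neighborFinset y with hP'
  have hle : R.card * (d * Fintype.card V) ≤ P.card + R.card * (2 * d * (d + 1) + F.card * 2) := by
    rw [hP, Finset.card_sigma, ← smul_eq_mul (a := R.card), ← smul_eq_mul (a := R.card),
      ← Finset.sum_const, ← Finset.sum_const, ← Finset.sum_add_distrib]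
    refine Finset.sum_le_sum fun G hG => ?_
    rw [hR, mem_regularContaining] at hG
    have hxy : G.Adj x y := hG.2 _ (Finset.mem_insert_self _ _)
    convert! card_switchable_ge hG.1 hxy F
  have hP'card : P'.card = (regularContaining V d F).card * (d * d) := by
    rw [hP', Finset.card_sigma, ← smul_eq_mul (a := (regularContaining V d F).card),
      ← Finset.sum_const]
    refine Finset.sum_congr rfl fun G hG => ?_
    have hdeg : ∀ v, (G.neighborFinset v).card = d := fun v => by
      rw [← (mem_regularContaining.1 hG).1 v, Set.ncard_eq_toFinset_card']; rfl
    rw [Finset.card_product, hdeg, hdeg]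
  have hPP' : P.card ≤ P'.card := by
    refine Finset.card_le_card_of_injOn (fun q => ⟨switching q.1 x y q.2.1 q.2.2, q.2⟩) ?_ ?_
    · rintro ⟨G, u, v⟩ hq
      simp only [hP, hP', Finset.coe_sigma, Set.mem_sigma_iff, Finset.mem_coe, Finset.mem_filter,
        Finset.mem_univ, true_and, hR, mem_regularContaining, Finset.mem_product,
        SimpleGraph.mem_neighborFinset] at hq ⊢
      obtain ⟨⟨hreg, hmem⟩, hsw, huv⟩ := hq
      refine ⟨⟨fun a => (hsw.ncard_neighborSet a).trans (hreg a), fun e he => ?_⟩, ?_, ?_⟩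
      · rw [hsw.edgeSet_switching]
        refine Or.inl ⟨hmem e (Finset.mem_insert_of_mem he), ?_⟩
        rintro (rfl | rfl)
        · exact hF he
        · exact huv he
      · rw [← SimpleGraph.mem_edgeSet, hsw.edgeSet_switching]; simp
      · rw [← SimpleGraph.mem_edgeSet, hsw.edgeSet_switching]; simp
    · rintro ⟨G, q⟩ hq ⟨G', q'⟩ hq' he
      simp only [Sigma.mk.injEq, heq_eq_eq] at he
      obtain ⟨he, rfl⟩ := he
      simp only [hP, Finset.coe_sigma, Set.mem_sigma_iff, Finset.mem_coe, Finset.mem_filter] at hq hq'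
      have h1 := hq.2.2.1.edgeSet_eq
      rw [he, ← hq'.2.2.1.edgeSet_eq] at h1
      rw [SimpleGraph.edgeSet_inj.1 h1]
  rw [hP'card] at hPP'
  omega

/-- A given set `F` of edges is contained in a proportion of at most `(2d/n)^|F|` of the
`d`-regular graphs on `n` vertices. -/
lemma card_regularContaining_mul_le {V : Type*} [Fintype V] {d L : ℕ} (hd : 0 < d)
    (hn : 4 * (d + 1) + 4 * L ≤ Fintype.card V) (F : Finset (Sym2 V)) (hF : F.card ≤ L) :
    (regularContaining V d F).card * Fintype.card V ^ F.card ≤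
      (2 * d) ^ F.card * (regularContaining V d ∅).card := by
  classical
  induction F using Finset.induction_on with
  | empty => simp
  | insert e F he ih =>
    have hFL : F.card + 1 ≤ L := by rwa [Finset.card_insert_of_notMem he] at hF
    have ih' := ih (by omega)
    rw [Finset.card_insert_of_notMem he]
    induction e using Sym2.ind with
    | _ x y =>
      have h := card_regularContaining_insert_mul_le d x y F he
      set N := (regularContaining V d (insert s(x, y) F)).card
      set n := Fintype.card V
      have h1 : N * n ≤ 2 * d * (regularContaining V d F).card := by
        -- The size of `n` makes the unusable edges at most half of all `d * n` orientations, whence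
        -- the factor 2 in `2 * d`.
        have h2 : 2 * (2 * d * (d + 1) + F.card * 2) ≤ d * n := by
          calc 2 * (2 * d * (d + 1) + F.card * 2) ≤ d * (4 * (d + 1) + 4 * L) := by nlinarith
            _ ≤ d * n := Nat.mul_le_mul_left d hn
        have h3 := Nat.mul_le_mul_left N h2
        have h4 : d * (N * n) ≤ d * (2 * d * (regularContaining V d F).card) := by nlinarith
        exact Nat.le_of_mul_le_mul_left h4 hd
      calc N * n ^ (F.card + 1) = N * n * n ^ F.card := by ring
        _ ≤ 2 * d * (regularContaining V d F).card * n ^ F.card := Nat.mul_le_mul_right _ h1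
        _ = 2 * d * ((regularContaining V d F).card * n ^ F.card) := by ring
        _ ≤ 2 * d * ((2 * d) ^ F.card * (regularContaining V d ∅).card) :=
            Nat.mul_le_mul_left _ ih'
        _ = _ := by ring

/-! ### Short cycles -/

/-- A cycle within the ball visits distinct vertices, so its length is at most the size of the ball.
-/
lemma exists_isCycle_of_not_isAcyclic {V : Type*} {G : SimpleGraph V} [G.LocallyFinite] {d : ℕ}
    (hd : G.IsRegularOfDegree d) {v : V} {r : ℕ} (h : ¬ (ballGraph G v r).IsAcyclic) :
    ∃ (a : V) (p : G.Walk a a), p.IsCycle ∧ p.length ≤ (d + 1) ^ r ∧ G.edist v a ≤ r := by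
  classical
  simp only [SimpleGraph.IsAcyclic, not_forall, not_not] at h
  obtain ⟨a, p, hp⟩ := h
  have hsupp : ∀ {a b : V} (p : (ballGraph G v r).Walk a b), ∀ z ∈ p.support.tail,
      G.edist v z ≤ r := by
    intro a b p
    induction p with
    | nil => simp
    | cons h p ih =>
      intro z hz
      rw [SimpleGraph.Walk.support_cons, List.tail_cons, SimpleGraph.Walk.mem_support_iff] at hz
      rcases hz with rfl | hz
      · exact h.2.2
      · exact ih z hz
  obtain ⟨s, hs, hs'⟩ := exists_finset_ball hd r v
  refine ⟨a, p.mapLe (ballGraph_le G v r), (SimpleGraph.Walk.isCycle_mapLe _).2 hp, ?_, ?_⟩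
  · rw [SimpleGraph.Walk.length_mapLe]
    have h1 : p.support.tail.toFinset.card = p.length := by
      rw [List.toFinset_card_of_nodup hp.support_nodup]; simp
    rw [← h1]
    refine (Finset.card_le_card fun z hz => ?_).trans hs
    exact hs' z (hsupp p z (by simpa using hz))
  · exact hsupp p a (SimpleGraph.Walk.end_mem_tail_support hp.not_nil)

lemma cyclicCount_eq_zero {V : Type*} {G : SimpleGraph V} [G.LocallyFinite] {d : ℕ}
    (hd : G.IsRegularOfDegree d) {r : ℕ} (h : (d + 1) ^ r < G.girth) : cyclicCount G r = 0 := by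
  have : IsEmpty {v // ¬ (ballGraph G v r).IsAcyclic} := by
    refine ⟨fun ⟨v, hv⟩ => ?_⟩
    obtain ⟨a, p, hp, hl, -⟩ := exists_isCycle_of_not_isAcyclic hd hv
    have := SimpleGraph.girth_le_length hp
    omega
  exact Nat.card_of_isEmpty

/-- Shows that girth tending to infinity forces the number of vertices to infinity. Forests have
girth 0 by convention. -/
lemma girth_le_card {V : Type*} [Fintype V] (G : SimpleGraph V) : G.girth ≤ Fintype.card V := by
  classical
  by_cases h : G.IsAcyclic
  · rw [SimpleGraph.girth_eq_zero.2 h]; exact Nat.zero_le _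
  · obtain ⟨a, p, hp, hl⟩ := SimpleGraph.exists_girth_eq_length.2 h
    have h1 : p.support.tail.length = p.length := by simp
    rw [hl, ← h1]
    exact hp.support_nodup.length_le_card

/-- The edges of the closed walk through the vertices of the sequence `f`. -/
def closedWalkEdges {V : Type*} [DecidableEq V] {l : ℕ} (f : Fin (l + 1) → V) : Finset (Sym2 V) :=
  Finset.univ.image fun i => s(f i, f (i + 1))

lemma exists_getVert_of_mem_edges {V : Type*} {G : SimpleGraph V} {a b : V} (p : G.Walk a b) :
    ∀ e ∈ p.edges, ∃ i < p.length, e = s(p.getVert i, p.getVert (i + 1)) := by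
  induction p with
  | nil => simp
  | cons h p ih =>
    intro e he
    rw [SimpleGraph.Walk.edges_cons, List.mem_cons] at he
    rcases he with rfl | he
    · exact ⟨0, by simp, by simp⟩
    · obtain ⟨i, hi, rfl⟩ := ih e he
      exact ⟨i + 1, by simpa using hi, by simp⟩

/-- Codes a cycle by a cyclic sequence of vertices. That its edges are distinct is essential: `l +
1` edges balance the `n^(l+1)` possible sequences. -/
lemma exists_closedWalkEdges_of_isCycle {V : Type*} [DecidableEq V] {G : SimpleGraph V} {a : V}
    {p : G.Walk a a} (hp : p.IsCycle) :
    ∃ (l : ℕ) (f : Fin (l + 1) → V), l + 1 = p.length ∧ f 0 = a ∧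
      (closedWalkEdges f).card = l + 1 ∧ ∀ e ∈ closedWalkEdges f, e ∈ G.edgeSet := by
  obtain ⟨l, hl⟩ : ∃ l, l + 1 = p.length := ⟨p.length - 1, by have := hp.three_le_length; omega⟩
  -- Addition in `Fin (l + 1)` wraps around, which is harmless because the walk is closed.
  have hstep : ∀ i : Fin (l + 1), p.getVert (i + 1 : Fin (l + 1)) = p.getVert (i + 1 : ℕ) := by
    intro i
    rw [Fin.val_add_one]
    split_ifs with h
    · rw [h, Fin.val_last, hl, SimpleGraph.Walk.getVert_length, SimpleGraph.Walk.getVert_zero]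
    · rfl
  refine ⟨l, fun i => p.getVert i, hl, by simp, ?_, ?_⟩
  · refine le_antisymm (Finset.card_image_le.trans (by simp)) ?_
    have h1 : p.edges.toFinset.card = l + 1 := by
      rw [List.toFinset_card_of_nodup hp.isTrail.edges_nodup, SimpleGraph.Walk.length_edges, hl]
    refine h1.ge.trans (Finset.card_le_card fun e he => ?_)
    obtain ⟨i, hi, rfl⟩ := exists_getVert_of_mem_edges p e (by simpa using he)
    refine Finset.mem_image.2 ⟨⟨i, by omega⟩, Finset.mem_univ _, ?_⟩
    simp only [hstep]
  · intro e he
    obtain ⟨i, -, rfl⟩ := Finset.mem_image.1 he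
    simp only [hstep]
    exact p.adj_getVert_succ (by have := i.2; omega)

lemma isRegularOfDegree_iff_ncard {V : Type*} {G : SimpleGraph V} [G.LocallyFinite] {d : ℕ} :
    G.IsRegularOfDegree d ↔ ∀ v, (G.neighborSet v).ncard = d := by
  refine forall_congr' fun v => ?_
  rw [Set.ncard_eq_toFinset_card']
  exact Iff.rfl

open Classical in
-- Every counted vertex lies within distance `r` of the starting vertex of a short cycle, and each
-- start accounts for at most `(d + 1)^r` vertices.
lemma cyclicCount_le_sum {V : Type*} [Fintype V] {d r : ℕ} {G : SimpleGraph V}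
    (hG : ∀ v, (G.neighborSet v).ncard = d) :
    cyclicCount G r ≤ ∑ l ∈ Finset.range ((d + 1) ^ r),
      ∑ f : Fin (l + 1) → V with (closedWalkEdges f).card = l + 1,
        if G ∈ regularContaining V d (closedWalkEdges f) then (d + 1) ^ r else 0 := by
  have hreg : G.IsRegularOfDegree d := isRegularOfDegree_iff_ncard.2 hG
  choose s hs hs' using exists_finset_ball hreg r
  rw [cyclicCount, Nat.card_eq_fintype_card, Fintype.card_subtype]
  have hsub : (Finset.univ.filter fun v => ¬ (ballGraph G v r).IsAcyclic) ⊆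
      (Finset.range ((d + 1) ^ r)).biUnion fun l =>
        (Finset.univ.filter fun f : Fin (l + 1) → V => (closedWalkEdges f).card = l + 1).biUnion
          fun f => if G ∈ regularContaining V d (closedWalkEdges f) then s (f 0) else ∅ := by
    intro v hv
    simp only [Finset.mem_filter, Finset.mem_univ, true_and] at hv
    obtain ⟨a, p, hp, hl, ha⟩ := exists_isCycle_of_not_isAcyclic hreg hv
    obtain ⟨l, f, hlp, hf0, hcard, hmem⟩ := exists_closedWalkEdges_of_isCycle hp
    simp only [Finset.mem_biUnion, Finset.mem_range, Finset.mem_filter, Finset.mem_univ, true_and]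
    refine ⟨l, by omega, f, hcard, ?_⟩
    rw [if_pos (mem_regularContaining.2 ⟨hG, hmem⟩), hf0]
    exact hs' a v (by rwa [SimpleGraph.edist_comm])
  refine (Finset.card_le_card hsub).trans (Finset.card_biUnion_le.trans ?_)
  refine Finset.sum_le_sum fun l _ => Finset.card_biUnion_le.trans ?_
  refine Finset.sum_le_sum fun f _ => ?_
  split_ifs
  · exact hs _
  · simp

/-- On average, a regular graph has a bounded number of vertices close to a short cycle. -/
lemma sum_cyclicCount_le {V : Type*} [Fintype V] {d r : ℕ} (hd : 0 < d)
    (hn : 4 * (d + 1) + 4 * (d + 1) ^ r ≤ Fintype.card V) :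
    ∑ G ∈ regularContaining V d ∅, cyclicCount G r ≤
      ((∑ l ∈ Finset.range ((d + 1) ^ r), (2 * d) ^ (l + 1)) * (d + 1) ^ r) *
        (regularContaining V d ∅).card := by
  classical
  set N := (regularContaining V d ∅).card
  -- There are at most `n^(l+1)` sequences, each realised in a proportion at most `(2d/n)^(l+1)` of
  -- the graphs; the powers of `n` cancel.
  have hone : ∀ l < (d + 1) ^ r, ∑ f : Fin (l + 1) → V with (closedWalkEdges f).card = l + 1,
      (regularContaining V d (closedWalkEdges f)).card ≤ (2 * d) ^ (l + 1) * N := by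
    intro l hl
    have hpos : 0 < Fintype.card V ^ (l + 1) := Nat.pow_pos (by omega)
    refine Nat.le_of_mul_le_mul_right ?_ hpos
    rw [Finset.sum_mul]
    calc _ ≤ ∑ f : Fin (l + 1) → V with (closedWalkEdges f).card = l + 1,
          (2 * d) ^ (l + 1) * N := by
          refine Finset.sum_le_sum fun f hf => ?_
          have hf' := (Finset.mem_filter.1 hf).2
          have := card_regularContaining_mul_le hd hn (closedWalkEdges f) (by omega)
          rwa [hf'] at this
      _ ≤ Fintype.card V ^ (l + 1) * ((2 * d) ^ (l + 1) * N) := by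
          rw [Finset.sum_const, smul_eq_mul]
          refine Nat.mul_le_mul_right _ ((Finset.card_le_univ _).trans ?_)
          simp
      _ = _ := by ring
  calc ∑ G ∈ regularContaining V d ∅, cyclicCount G r
      ≤ ∑ G ∈ regularContaining V d ∅, ∑ l ∈ Finset.range ((d + 1) ^ r),
        ∑ f : Fin (l + 1) → V with (closedWalkEdges f).card = l + 1,
          if G ∈ regularContaining V d (closedWalkEdges f) then (d + 1) ^ r else 0 :=
        Finset.sum_le_sum fun G hG => cyclicCount_le_sum (mem_regularContaining.1 hG).1
    _ = ∑ l ∈ Finset.range ((d + 1) ^ r),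
        (∑ f : Fin (l + 1) → V with (closedWalkEdges f).card = l + 1,
          (regularContaining V d (closedWalkEdges f)).card) * (d + 1) ^ r := by
        rw [Finset.sum_comm]
        refine Finset.sum_congr rfl fun l _ => ?_
        rw [Finset.sum_comm, Finset.sum_mul]
        refine Finset.sum_congr rfl fun f _ => ?_
        rw [← Finset.sum_filter, Finset.sum_const, smul_eq_mul]
        congr 2
        ext G
        simp only [Finset.mem_filter, mem_regularContaining]
        constructor
        · exact fun h => h.2
        · exact fun h => ⟨⟨h.1, by simp⟩, h⟩
    _ ≤ ∑ l ∈ Finset.range ((d + 1) ^ r), ((2 * d) ^ (l + 1) * N) * (d + 1) ^ r :=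
        Finset.sum_le_sum fun l hl => Nat.mul_le_mul_right _ (hone l (Finset.mem_range.1 hl))
    _ = _ := by
        rw [← Finset.sum_mul, ← Finset.sum_mul]; ring

/-! ### Existence of regular graphs -/

/-- The Cayley graph of `A` with connection set `S`. -/
lemma exists_regular_of_symmetric {A : Type*} [AddCommGroup A] (S : Finset A) (h0 : (0 : A) ∉ S)
    (hS : ∀ s ∈ S, -s ∈ S) : ∃ G : SimpleGraph A, ∀ v, (G.neighborSet v).ncard = S.card := by
  refine ⟨{ Adj := fun a b => b - a ∈ S
            symm := ⟨fun a b h => by simpa using hS _ h⟩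
            loopless := ⟨fun a h => h0 (by simpa using h)⟩ }, fun v => ?_⟩
  rw [← Set.ncard_coe_finset, ← Set.ncard_image_of_injective (S : Set A) (add_right_injective v)]
  congr 1
  ext b
  simp only [SimpleGraph.mem_neighborSet, Set.mem_image, Finset.mem_coe]
  exact ⟨fun h => ⟨b - v, h, by simp⟩, by rintro ⟨s, hs, rfl⟩; simpa using hs⟩

/-- A circulant graph: join each residue to those at distance at most `d / 2`, and for odd `d` also
to the antipode, which exists because `m + 1` is then even. Without such a graph the uniform
probability would be `0 / 0`. -/
lemma exists_regular (d m : ℕ) (hd : d ≤ m) (he : Even (d * (m + 1))) :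
    ∃ G : SimpleGraph (Fin (m + 1)), ∀ v, (G.neighborSet v).ncard = d := by
  classical
  set j := d / 2 with hj
  set S : Finset (Fin (m + 1)) := Finset.univ.filter fun i =>
    (1 ≤ i.val ∧ i.val ≤ j) ∨ m + 1 - j ≤ i.val ∨ (d % 2 = 1 ∧ 2 * i.val = m + 1) with hSdef
  have hpar : d % 2 = 1 → (m + 1) % 2 = 0 := by
    intro h
    rw [Nat.even_mul, Nat.even_iff, Nat.even_iff] at he
    omega
  have hcard : S.card = d := by
    have : S.map Fin.valEmbedding = (Finset.Icc 1 j ∪ Finset.Ico (m + 1 - j) (m + 1)) ∪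
        (if d % 2 = 1 then {(m + 1) / 2} else ∅) := by
      ext i
      simp only [hSdef, Finset.mem_map, Finset.mem_filter, Finset.mem_univ, true_and,
        Fin.valEmbedding_apply, Finset.mem_union, Finset.mem_Icc, Finset.mem_Ico]
      constructor
      · rintro ⟨a, h, rfl⟩
        have := a.2
        split_ifs with h2
        · simp only [Finset.mem_singleton]; omega
        · simp only [Finset.notMem_empty]; omega
      · intro h
        split_ifs at h with h2
        · simp only [Finset.mem_singleton] at h
          have := hpar h2
          exact ⟨⟨i, by omega⟩, by simp only; omega, rfl⟩
        · simp only [Finset.notMem_empty, or_false] at h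
          exact ⟨⟨i, by omega⟩, by simp only; omega, rfl⟩
    rw [← Finset.card_map Fin.valEmbedding, this, Finset.card_union_of_disjoint,
      Finset.card_union_of_disjoint, Nat.card_Icc, Nat.card_Ico]
    · split_ifs with h2 <;> simp <;> omega
    · rw [Finset.disjoint_left]
      intro i; simp only [Finset.mem_Icc, Finset.mem_Ico]; omega
    · rw [Finset.disjoint_left]
      intro i
      simp only [Finset.mem_union, Finset.mem_Icc, Finset.mem_Ico]
      split_ifs with h2
      · have := hpar h2
        simp only [Finset.mem_singleton]; omega
      · simp
  obtain ⟨G, hG⟩ := exists_regular_of_symmetric S (by simp [hSdef]; omega) (fun s hs => by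
    simp only [hSdef, Finset.mem_filter, Finset.mem_univ, true_and] at hs ⊢
    have hlt := s.2
    have hs0 : s.val ≠ 0 := by omega
    have : (-s).val = m + 1 - s.val := by
      rw [Fin.val_neg', Nat.mod_eq_of_lt (by omega)]
    rw [this]; omega)
  exact ⟨G, fun v => (hG v).trans hcard⟩

/-! ### Uniform probabilities -/

lemma uniformProb_le_one {Ω : Type*} [Finite Ω] (p : Ω → Prop) : uniformProb Ω p ≤ 1 := by
  refine div_le_one_of_le₀ ?_ (Nat.cast_nonneg _)
  exact_mod_cast Nat.card_le_card_of_injective (fun ω : {ω // p ω} => ω.1) Subtype.val_injective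

/-- Conditioning on the first coordinate: the random graph is drawn first, then the ordering. -/
lemma mul_uniformProb_le_uniformProb_prod {A B : Type*} [Finite A] [Finite B] [Nonempty B]
    {good : A → Prop} {p : A × B → Prop} {q : ℝ}
    (h : ∀ a, good a → q ≤ uniformProb B (fun b => p (a, b))) :
    q * uniformProb A good ≤ uniformProb (A × B) p := by
  classical
  have := Fintype.ofFinite A
  have := Fintype.ofFinite B
  have hB : 0 < (Nat.card B : ℝ) := by exact_mod_cast Nat.card_pos
  have h1 : (Nat.card {ω : A × B // p ω} : ℝ) = ∑ a : A, (Nat.card {b // p (a, b)} : ℝ) := by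
    rw [Nat.card_congr (Equiv.subtypeProdEquivSigmaSubtype fun a b => p (a, b)), Nat.card_sigma]
    push_cast; rfl
  have h2 : (Nat.card {a // good a} : ℝ) * (q * Nat.card B) ≤ Nat.card {ω : A × B // p ω} := by
    rw [h1, Nat.card_eq_fintype_card, Fintype.card_subtype, ← nsmul_eq_mul, ← Finset.sum_const]
    calc _ ≤ ∑ a with good a, (Nat.card {b // p (a, b)} : ℝ) := by
          refine Finset.sum_le_sum fun a ha => ?_
          have := h a (Finset.mem_filter.1 ha).2
          rwa [uniformProb, le_div_iff₀ hB] at this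
      _ ≤ _ := Finset.sum_le_sum_of_subset_of_nonneg (Finset.filter_subset _ _)
          fun _ _ _ => Nat.cast_nonneg _
  rw [uniformProb, uniformProb, Nat.card_prod]
  push_cast
  rw [← div_div, le_div_iff₀ hB]
  rcases isEmpty_or_nonempty A with hA | hA
  · simp
  · have hA' : 0 < (Nat.card A : ℝ) := by exact_mod_cast Nat.card_pos
    rw [mul_assoc, div_mul_eq_mul_div, mul_div_assoc', div_le_div_iff_of_pos_right hA']
    linarith

/-! ### Random regular graphs -/

lemma mem_regularContaining_empty {n d : ℕ} {G : SimpleGraph (Fin n)} :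
    G ∈ regularContaining (Fin n) d ∅ ↔ ∀ v, (G.neighborSet v).ncard = d := by
  simp [mem_regularContaining]

open Classical in
/-- The `d`-regular graphs on `Fin n` as a finite set. -/
noncomputable def regularGraphEquiv (n d : ℕ) :
    RegularGraphOn n d ≃ regularContaining (Fin n) d ∅ :=
  Equiv.subtypeEquivRight fun G => by
    rw [mem_regularContaining_empty, isRegularOfDegree_iff_ncard]

/-- Markov's inequality for the number of vertices close to a short cycle. -/
lemma uniformProb_cyclicCount_ge {n d r : ℕ} (hd : 0 < d)
    (hn : 4 * (d + 1) + 4 * (d + 1) ^ r ≤ n) (hne : Nonempty (RegularGraphOn n d)) {δ : ℝ}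
    (hδ : 0 < δ) :
    1 - (((∑ l ∈ Finset.range ((d + 1) ^ r), (2 * d) ^ (l + 1)) * (d + 1) ^ r : ℕ) : ℝ) / δ / n ≤
      uniformProb (RegularGraphOn n d) (fun G => (cyclicCount G.1 r : ℝ) ≤ δ * n) := by
  classical
  set K := (∑ l ∈ Finset.range ((d + 1) ^ r), (2 * d) ^ (l + 1)) * (d + 1) ^ r
  set R := regularContaining (Fin n) d ∅
  have hcard : Nat.card (RegularGraphOn n d) = R.card := by
    rw [Nat.card_congr (regularGraphEquiv n d)]; simp [R]
  have hgood : Nat.card {G : RegularGraphOn n d // (cyclicCount G.1 r : ℝ) ≤ δ * n} =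
      (R.filter fun G => (cyclicCount G r : ℝ) ≤ δ * n).card := by
    rw [← Fintype.card_coe, ← Nat.card_eq_fintype_card]
    exact Nat.card_congr
      { toFun := fun G => ⟨G.1.1, Finset.mem_filter.2 ⟨(regularGraphEquiv n d G.1).2, G.2⟩⟩
        invFun := fun G => ⟨(regularGraphEquiv n d).symm ⟨G.1, (Finset.mem_filter.1 G.2).1⟩,
          (Finset.mem_filter.1 G.2).2⟩
        left_inv := fun _ => rfl
        right_inv := fun _ => rfl }
  have hsum := sum_cyclicCount_le (V := Fin n) (r := r) hd (by simpa using hn)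
  have hR : 0 < (R.card : ℝ) := by
    rw [← hcard]; exact_mod_cast Nat.card_pos
  have hn0 : 0 < (n : ℝ) := by
    have : 0 < n := by omega
    exact_mod_cast this
  have hsplit := Finset.card_filter_add_card_filter_not (s := R)
    (fun G => (cyclicCount G r : ℝ) ≤ δ * n)
  have hbad : ((R.filter fun G => ¬ (cyclicCount G r : ℝ) ≤ δ * n).card : ℝ) * (δ * n) ≤
      K * R.card := by
    calc _ = ∑ _G ∈ R.filter fun G => ¬ (cyclicCount G r : ℝ) ≤ δ * n, δ * (n : ℝ) := by simp
      _ ≤ ∑ G ∈ R.filter fun G => ¬ (cyclicCount G r : ℝ) ≤ δ * n, (cyclicCount G r : ℝ) :=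
          Finset.sum_le_sum fun G hG => (not_le.1 (Finset.mem_filter.1 hG).2).le
      _ ≤ ∑ G ∈ R, (cyclicCount G r : ℝ) :=
          Finset.sum_le_sum_of_subset_of_nonneg (Finset.filter_subset _ _)
            fun _ _ _ => Nat.cast_nonneg _
      _ ≤ K * R.card := by exact_mod_cast hsum
  rw [uniformProb, hcard, hgood, le_div_iff₀ hR, sub_mul, one_mul, div_div]
  have h1 : ((R.filter fun G => (cyclicCount G r : ℝ) ≤ δ * n).card : ℝ) +
      ((R.filter fun G => ¬ (cyclicCount G r : ℝ) ≤ δ * n).card : ℝ) = R.card := by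
    exact_mod_cast hsplit
  have h2 : ((R.filter fun G => ¬ (cyclicCount G r : ℝ) ≤ δ * n).card : ℝ) ≤
      K / (δ * n) * R.card := by
    rw [div_mul_eq_mul_div, le_div_iff₀ (by positivity)]; exact hbad
  linarith

lemma tendsto_uniformProb_of_girth {d : ℕ} (hd : 3 ≤ d) {c : ℝ}
    (hc : c = 1 / 2 * (1 - ((d : ℝ) - 1) ^ (-2 / ((d : ℝ) - 2)))) {V : ℕ → Type*}
    [∀ n, Fintype (V n)] (G : ∀ n, SimpleGraph (V n)) [∀ n, (G n).LocallyFinite]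
    (hreg : ∀ n, (G n).IsRegularOfDegree d) (hg : Tendsto (fun n => (G n).girth) atTop atTop)
    {ε : ℝ} (hε : 0 < ε) :
    Tendsto (fun n => uniformProb (VertexOrder (V n))
      (fun π => |greedyRatio (G n) π - c| < ε)) atTop (𝓝 1) := by
  obtain ⟨r, C, hC⟩ := exists_uniformProb_ge hd hc hε
  have hcard : Tendsto (fun n => (Fintype.card (V n) : ℝ)) atTop atTop :=
    tendsto_natCast_atTop_atTop.comp (tendsto_atTop_mono (fun n => girth_le_card (G n)) hg)
  have hlow : Tendsto (fun n => 1 - C / (Fintype.card (V n) : ℝ)) atTop (𝓝 1) := by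
    simpa using (hcard.const_div_atTop C).const_sub 1
  refine tendsto_of_tendsto_of_tendsto_of_le_of_le' hlow tendsto_const_nhds ?_
    (Eventually.of_forall fun n => uniformProb_le_one _)
  filter_upwards [hg.eventually_gt_atTop ((d + 1) ^ r)] with n hn
  have : Nonempty (V n) := Fintype.card_pos_iff.1 (by have := girth_le_card (G n); omega)
  refine hC (V n) (G n) (hreg n) ?_
  rw [cyclicCount_eq_zero (hreg n) hn]
  simp only [Nat.cast_zero]
  positivity

lemma tendsto_uniformProb_regularGraphOn {d : ℕ} (hd : 3 ≤ d) {c : ℝ}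
    (hc : c = 1 / 2 * (1 - ((d : ℝ) - 1) ^ (-2 / ((d : ℝ) - 2)))) {ε : ℝ} (hε : 0 < ε) :
    Tendsto (fun n : ℕ => uniformProb (RegularGraphOn n d × VertexOrder (Fin n))
      (fun ω => |greedyRatio ω.1.1 ω.2 - c| < ε))
      (atTop ⊓ 𝓟 {n : ℕ | Even (d * n)}) (𝓝 1) := by
  classical
  obtain ⟨r, C, hC⟩ := exists_uniformProb_ge hd hc hε
  set K : ℝ := (((∑ l ∈ Finset.range ((d + 1) ^ r), (2 * d) ^ (l + 1)) * (d + 1) ^ r : ℕ) : ℝ)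
  have hlow1 : Tendsto (fun n : ℕ => 1 - C / (n : ℝ)) atTop (𝓝 1) := by
    simpa using (tendsto_natCast_atTop_atTop.const_div_atTop C).const_sub 1
  have hlow2 : Tendsto (fun n : ℕ => 1 - K / (ε / 4) / (n : ℝ)) atTop (𝓝 1) := by
    simpa using (tendsto_natCast_atTop_atTop.const_div_atTop (K / (ε / 4))).const_sub 1
  have hlow : Tendsto (fun n : ℕ => (1 - C / (n : ℝ)) * (1 - K / (ε / 4) / (n : ℝ)))
      (atTop ⊓ 𝓟 {n : ℕ | Even (d * n)}) (𝓝 1) := by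
    have := hlow1.mul hlow2
    rw [mul_one] at this
    exact this.mono_left inf_le_left
  refine tendsto_of_tendsto_of_tendsto_of_le_of_le' hlow tendsto_const_nhds ?_
    (Eventually.of_forall fun n => uniformProb_le_one _)
  -- Nonnegativity of the first factor is needed to multiply it with the lower bound on the
  -- proportion of good graphs.
  have hev : ∀ᶠ n : ℕ in atTop, 4 * (d + 1) + 4 * (d + 1) ^ r ≤ n ∧ 0 ≤ 1 - C / (n : ℝ) :=
    (eventually_ge_atTop _).and (hlow1.eventually (eventually_ge_nhds one_pos))
  rw [eventually_inf_principal]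
  filter_upwards [hev] with n ⟨hn, hCn⟩ heven
  obtain ⟨m, rfl⟩ : ∃ m, n = m + 1 := ⟨n - 1, by omega⟩
  have hne : Nonempty (RegularGraphOn (m + 1) d) := by
    obtain ⟨G, hG⟩ := exists_regular d m (by omega) heven
    exact ⟨(regularGraphEquiv (m + 1) d).symm ⟨G, mem_regularContaining_empty.2 hG⟩⟩
  have : Nonempty (VertexOrder (Fin (m + 1))) := ⟨(Fintype.equivFin _).symm⟩
  refine (mul_le_mul_of_nonneg_left
    (uniformProb_cyclicCount_ge (by omega) hn hne (by positivity : 0 < ε / 4)) hCn).trans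
    (mul_uniformProb_le_uniformProb_prod fun G hG => ?_)
  have := hC (Fin (m + 1)) G.1 (isRegularOfDegree_iff_ncard.2 (isRegularOfDegree_iff_ncard.1 G.2))
    (by simpa using hG)
  simpa using this

theorem mainTheorem8 (d : ℕ) (hd : 3 ≤ d) (c : ℝ)
    (hc : c = 1 / 2 * (1 - ((d : ℝ) - 1) ^ (-2 / ((d : ℝ) - 2)))) :
    -- the `d`-regular tree, with an arbitrary root
    (∀ (V : Type*) (T : SimpleGraph V) [T.LocallyFinite] (ρ : V),
      T.IsTree → T.IsRegularOfDegree d →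
        NonexplosiveGrowth T ρ ∧ greedyDensity T ρ = c) ∧
    -- every sequence of finite `d`-regular graphs with girth tending to infinity
    (∀ (V : ℕ → Type*) [∀ n, Fintype (V n)] (G : ∀ n, SimpleGraph (V n))
      [∀ n, (G n).LocallyFinite],
      (∀ n, (G n).IsRegularOfDegree d) →
      Tendsto (fun n => (G n).girth) atTop atTop →
        ∀ ε : ℝ, 0 < ε →
          Tendsto (fun n => uniformProb (VertexOrder (V n))
            (fun π => |greedyRatio (G n) π - c| < ε)) atTop (𝓝 1)) ∧
    -- the random `d`-regular graph on `n` vertices, as `n` tends to infinity with `d * n` even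
    (∀ ε : ℝ, 0 < ε →
      Tendsto (fun n : ℕ => uniformProb (RegularGraphOn n d × VertexOrder (Fin n))
        (fun ω => |greedyRatio ω.1.1 ω.2 - c| < ε))
        (atTop ⊓ 𝓟 {n : ℕ | Even (d * n)}) (𝓝 1)) := by
  refine ⟨fun V T _ ρ hT hreg => ⟨nonexplosiveGrowth_of_isRegularOfDegree hreg ρ,
    greedyDensity_tree hd hc ρ hT hreg⟩, ?_, ?_⟩
  · intro V _ G _ hreg hg ε hε
    exact tendsto_uniformProb_of_girth hd hc G hreg hg hε
  · intro ε hε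
    exact tendsto_uniformProb_regularGraphOn hd hc hε
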